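/- Let $D\ge 1$ and $\ell\ge 2$ be integers and, for $n\ge 0$, let $\mathcal F_n$ be the family of $\ell$-adic cubes $\prod_{i=1}^D[k_i/\ell^n,(k_i+1)/\ell^n)$, $0\le k_i<\ell^n$. Let the cubes be coded by words over the alphabet $\{0,\dots,\ell^D-1\}$, that is, for every $n$ the map $\varepsilon_1\cdots\varepsilon_n\mapsto I_{\varepsilon_1\cdots\varepsilon_n}$ is a bijection from the words of length $n$ onto $\mathcal F_n$, and $I_{\varepsilon_1\cdots\varepsilon_{n+1}}\subset I_{\varepsilon_1\cdots\varepsilon_n}$. For $I=I_{\varepsilon_1\cdots\varepsilon_n}$ and $J=I_{\eta_1\cdots\eta_p}$ write $IJ=I_{\varepsilon_1\cdots\varepsilon_n\eta_1\cdots\eta_p}$. Let $m$ be a quasi-Bernoulli measure on $[0,1)^D$, i.e. a Borel probability measure on $\mathbb R^D$ with $m([0,1)^D)=1$ for which there is a constant $C\ge 1$ such that $$\frac1C\,m(I)\,m(J)\le m(IJ)\le C\,m(I)\,m(J)\qquad\text{for all } I,J\in\bigcup_n\mathcal F_n .$$ Suppose that its $L^q$-spectrum $$\tau(q)=\limsup_{n\to\infty}\frac1{n\log\ell}\log\Big(\sum_{I\in\mathcal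 F_n,\ m(I)>0}m(I)^q\Big),\qquad q\in\mathbb R,$$ is real analytic on $\mathbb R$. Denote by $\dim$ the Hausdorff dimension of sets, by $\operatorname{supp}(m)$ the closed support of $m$ in $\mathbb R^D$, by $\mathcal H^s$ the $s$-dimensional Hausdorff measure, and by $\widehat{\mathcal P}^s$ the $s$-dimensional packing measure $\widehat{\mathcal P}^s(A)=\inf\{\sum_j\mathcal P^s(A_j):\ A\subset\bigcup_{j\in\mathbb N}A_j\}$, where $\mathcal P^s(A)=\lim_{\varepsilon\to0}\sup\sum_i(2r_i)^s$, the supremum being over the families of pairwise disjoint closed balls with centres in $A$ and radii $r_i\in(0,\varepsilon]$. Then $m$ is unidimensional, i.e. the lower dimension $\inf\{\dim A: A \text{ Borel},\ m(A)>0\}$ and the upper dimension $\inf\{\dim A: A\text{ Borel},\ m(A)=1\}$ have a common value $d=\dim(m)$, and with $\delta=\dim(\operatorname{supp}(m))$ one of the following two (mutually exclusive) cases occurs: (i) $d=\delta$ and $m$ is strongly equivalent to $\mathcal H^\delta$ on $\operatorname{supp}(m)$: there is a constant $C\ge1$ such that $\frac1C\mathcal H^\delta(A\cap\operatorname{supp}(m))\le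 m(A)\le C\,\mathcal H^\delta(A\cap\operatorname{supp}(m))$ for every Borel set $A$; (ii) $d<\delta$, and $m$ is singular with respect to $\mathcal H^d$ but absolutely continuous with respect to $\widehat{\mathcal P}^d$. -/

import Mathlib

open MeasureTheory Measure Set Filter
open scoped ENNReal NNReal Topology

noncomputable section

namespace QB

/-- `ℝ^D` with its Euclidean metric and Borel `σ`-algebra. -/
abbrev E (D : ℕ) : Type := EuclideanSpace ℝ (Fin D)

/-! ### Packing measures -/

section Packing

variable {X : Type*} [MetricSpace X]

/-- A finite family of pairwise disjoint closed balls (coded as pairs centre/radius) with centres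
in `A` and radii in `(0, ε]`. -/
def IsPacking (A : Set X) (ε : ℝ) (P : Finset (X × ℝ)) : Prop :=
  (∀ p ∈ P, p.1 ∈ A ∧ 0 < p.2 ∧ p.2 ≤ ε) ∧
    (P : Set (X × ℝ)).PairwiseDisjoint (fun p => Metric.closedBall p.1 p.2)

/-- Supremum of `∑ (2 rᵢ)^s` over the packings of `A` by balls of radius `rᵢ ≤ ε`. Passing from
finite to countable packings would not change the supremum. -/
def packingPreAt (s ε : ℝ) (A : Set X) : ℝ≥0∞ :=
  ⨆ (P : Finset (X × ℝ)) (_ : IsPacking A ε P), ∑ p ∈ P, ENNReal.ofReal ((2 * p.2) ^ s)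

/-- The packing pre-measure: the limit (infimum) of `packingPreAt s ε A` as `ε ↓ 0`. -/
def packingPre (s : ℝ) (A : Set X) : ℝ≥0∞ :=
  ⨅ (ε : ℝ) (_ : 0 < ε), packingPreAt s ε A

lemma packingPreAt_mono (s : ℝ) {ε ε' : ℝ} (h : ε ≤ ε') {A B : Set X} (hAB : A ⊆ B) :
    packingPreAt s ε A ≤ packingPreAt s ε' B := by
  refine iSup₂_le fun P hP => ?_
  refine le_iSup₂_of_le P ⟨fun p hp => ?_, hP.2⟩ le_rfl
  obtain ⟨h1, h2, h3⟩ := hP.1 p hp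
  exact ⟨hAB h1, h2, h3.trans h⟩

lemma packingPre_mono (s : ℝ) {A B : Set X} (hAB : A ⊆ B) :
    packingPre s A ≤ packingPre s B :=
  iInf₂_mono fun _ _ => packingPreAt_mono s le_rfl hAB

lemma packingPre_empty (s : ℝ) : packingPre s (∅ : Set X) = 0 := by
  refine le_antisymm ((iInf₂_le (1 : ℝ) one_pos).trans ?_) bot_le
  refine iSup₂_le fun P hP => ?_
  have : P = ∅ := Finset.eq_empty_of_forall_notMem fun p hp => (hP.1 p hp).1
  simp [this]

lemma packingPre_add_le (s : ℝ) {A B : Set X} (h : Metric.AreSeparated A B) :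
    packingPre s A + packingPre s B ≤ packingPre s (A ∪ B) := by
  classical
  obtain ⟨r, hr0, hr⟩ := h
  obtain ⟨ρ, hρ0, hρ⟩ : ∃ ρ : ℝ, 0 < ρ ∧ ENNReal.ofReal (2 * ρ) < r := by
    obtain ⟨c, hc0, hc⟩ := ENNReal.lt_iff_exists_nnreal_btwn.1 (pos_iff_ne_zero.2 hr0)
    refine ⟨c / 2, by have : (0 : ℝ) < c := by exact_mod_cast hc0
                      positivity, ?_⟩
    rw [mul_div_cancel₀ (c : ℝ) two_ne_zero, ENNReal.ofReal_coe_nnreal]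
    exact hc
  refine le_iInf₂ fun ε hε => ?_
  have hm : 0 < min ε ρ := lt_min hε hρ0
  refine (add_le_add (iInf₂_le _ hm) (iInf₂_le _ hm)).trans ?_
  refine le_trans ?_ (packingPreAt_mono s (min_le_left ε ρ) subset_rfl)
  unfold packingPreAt
  refine ENNReal.biSup_add_biSup_le' ⟨∅, by simp [IsPacking]⟩ ⟨∅, by simp [IsPacking]⟩ ?_
  intro P hP Q hQ
  have hfar : ∀ p ∈ P, ∀ q ∈ Q,
      Disjoint (Metric.closedBall p.1 p.2) (Metric.closedBall q.1 q.2) := by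
    intro p hp q hq
    obtain ⟨hp1, hp2, hp3⟩ := hP.1 p hp
    obtain ⟨hq1, hq2, hq3⟩ := hQ.1 q hq
    apply Metric.closedBall_disjoint_closedBall
    by_contra! hle
    have h1 := hr _ hp1 _ hq1
    rw [edist_dist] at h1
    have h2 : dist p.1 q.1 ≤ 2 * ρ := by
      have := min_le_right ε ρ
      linarith
    exact absurd (h1.trans (ENNReal.ofReal_le_ofReal h2)) (not_le.2 hρ)
  have hdisj : Disjoint P Q := by
    rw [Finset.disjoint_left]
    intro p hp hq
    have hne : (Metric.closedBall p.1 p.2).Nonempty :=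
      Metric.nonempty_closedBall.2 (hP.1 p hp).2.1.le
    exact hne.ne_empty (disjoint_self.1 (hfar p hp p hq))
  refine le_iSup₂_of_le (P ∪ Q) ⟨?_, ?_⟩ (Finset.sum_union hdisj).ge
  · intro p hp
    rcases Finset.mem_union.1 hp with hp | hp
    · exact ⟨Or.inl (hP.1 p hp).1, (hP.1 p hp).2⟩
    · exact ⟨Or.inr (hQ.1 p hp).1, (hQ.1 p hp).2⟩
  · rw [Finset.coe_union, pairwiseDisjoint_union]
    exact ⟨hP.2, hQ.2, fun p hp q hq _ => hfar p hp q hq⟩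

/-- The packing outer measure: the infimum of `∑ᵢ packingPre s (Aᵢ)` over countable covers. -/
def packingOuter (s : ℝ) : OuterMeasure X :=
  OuterMeasure.ofFunction (packingPre s) (packingPre_empty s)

lemma packingOuter_isMetric (s : ℝ) : (packingOuter s : OuterMeasure X).IsMetric := by
  intro A B h
  refine le_antisymm (measure_union_le A B) ?_
  unfold packingOuter
  rw [OuterMeasure.ofFunction_apply _ _ (A ∪ B)]
  refine le_iInf₂ fun t ht => ?_
  have hA : A ⊆ ⋃ i, t i ∩ A := by
    rw [← iUnion_inter]
    exact subset_inter (subset_union_left.trans ht) subset_rfl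
  have hB : B ⊆ ⋃ i, t i ∩ B := by
    rw [← iUnion_inter]
    exact subset_inter (subset_union_right.trans ht) subset_rfl
  rw [OuterMeasure.ofFunction_apply, OuterMeasure.ofFunction_apply]
  refine (add_le_add (iInf₂_le (fun i => t i ∩ A) hA) (iInf₂_le (fun i => t i ∩ B) hB)).trans ?_
  rw [← ENNReal.tsum_add]
  refine ENNReal.tsum_le_tsum fun i => ?_
  refine (packingPre_add_le s (h.mono inter_subset_right inter_subset_right)).trans ?_
  exact packingPre_mono s (union_subset inter_subset_left inter_subset_left)

/-- The `s`-dimensional packing measure, as a Borel measure. -/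
def packingMeasure [MeasurableSpace X] [BorelSpace X] (s : ℝ) : Measure X :=
  (packingOuter s).toMeasure
    ((BorelSpace.measurable_eq (α := X)).trans_le (packingOuter_isMetric s).borel_le_caratheodory)

end Packing

/-! ### Lower and upper Hausdorff dimension of a measure -/

/-- `dim_*(m) = inf {dim A ; m(A) > 0}`. -/
def lowerDim {D : ℕ} (m : Measure (E D)) : ℝ≥0∞ :=
  ⨅ (A : Set (E D)) (_ : MeasurableSet A) (_ : 0 < m A), dimH A

/-- `dim^*(m) = inf {dim A ; m(A) = 1}`. -/
def upperDim {D : ℕ} (m : Measure (E D)) : ℝ≥0∞ :=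
  ⨅ (A : Set (E D)) (_ : MeasurableSet A) (_ : m A = 1), dimH A

/-- The measure `m` is unidimensional with dimension `d`. -/
def HasDim {D : ℕ} (m : Measure (E D)) (d : ℝ≥0∞) : Prop :=
  lowerDim m = d ∧ upperDim m = d

/-- Two measures are strongly equivalent if each is bounded by a constant multiple of the other
on Borel sets. -/
def StronglyEquivalent {D : ℕ} (μ ν : Measure (E D)) : Prop :=
  ∃ C : ℝ≥0, 1 ≤ C ∧ ∀ A : Set (E D), MeasurableSet A →
    (C : ℝ≥0∞)⁻¹ * ν A ≤ μ A ∧ μ A ≤ C * ν A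

/-! ### `ℓ`-adic cubes and quasi-Bernoulli measures -/

/-- The unit cube `[0,1)^D`. -/
def unitCube (D : ℕ) : Set (E D) := {x | ∀ i, 0 ≤ x i ∧ x i < 1}

/-- The `ℓ`-adic cube `∏ i, [k i / ℓ^n, (k i + 1) / ℓ^n)` of generation `n`. -/
def cube {D : ℕ} (ℓ n : ℕ) (k : Fin D → Fin (ℓ ^ n)) : Set (E D) :=
  {x | ∀ i, ((k i : ℕ) : ℝ) / (ℓ : ℝ) ^ n ≤ x i ∧ x i < (((k i : ℕ) : ℝ) + 1) / (ℓ : ℝ) ^ n}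

/-- The family of all `ℓ`-adic cubes of generation `n` in `[0,1)^D`. -/
def cubes (D ℓ n : ℕ) : Set (Set (E D)) := range (cube (D := D) ℓ n)

/-- A coding of the `ℓ`-adic cubes by words over the alphabet `{0, …, ℓ^D - 1}`: words of length
`n` correspond bijectively to cubes of generation `n`, and extending the word shrinks the cube. -/
structure IsCoding {D ℓ : ℕ} (I : List (Fin (ℓ ^ D)) → Set (E D)) : Prop where
  bijOn : ∀ n : ℕ, BijOn I {w | w.length = n} (cubes D ℓ n)
  nested : ∀ (w : List (Fin (ℓ ^ D))) (a : Fin (ℓ ^ D)), I (w ++ [a]) ⊆ I w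

/-- A quasi-Bernoulli probability measure on `[0,1)^D` with respect to the coding `I`; the cube
obtained by concatenating `I u` and `I v` is `I (u ++ v)`. -/
structure IsQuasiBernoulli {D ℓ : ℕ} (I : List (Fin (ℓ ^ D)) → Set (E D))
    (m : Measure (E D)) : Prop where
  isProbabilityMeasure : IsProbabilityMeasure m
  measure_unitCube : m (unitCube D) = 1
  quasi : ∃ C : ℝ, 1 ≤ C ∧ ∀ u v : List (Fin (ℓ ^ D)),
    1 / C * (m.real (I u) * m.real (I v)) ≤ m.real (I (u ++ v)) ∧
      m.real (I (u ++ v)) ≤ C * (m.real (I u) * m.real (I v))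

/-- `∑ m(I)^q` over the cubes `I` of generation `n` that are charged by `m`. -/
def partitionSum {D : ℕ} (ℓ : ℕ) (m : Measure (E D)) (n : ℕ) (q : ℝ) : ℝ :=
  ∑ k : Fin D → Fin (ℓ ^ n), if m.real (cube ℓ n k) = 0 then 0 else m.real (cube ℓ n k) ^ q

/-- The `L^q`-spectrum `τ(q) = limsup_n (1 / (n log ℓ)) log ∑ m(I)^q`. -/
def lqSpectrum {D : ℕ} (ℓ : ℕ) (m : Measure (E D)) (q : ℝ) : ℝ :=
  limsup (fun n : ℕ => 1 / ((n : ℝ) * Real.log ℓ) * Real.log (partitionSum ℓ m n q)) atTop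

end QB

end

/-!
Write `p` for the quasi-Bernoulli measure as a function on words. Almost additivity of the
logarithms of its partition functions (Fekete) turns `τ` into the convex function for which
`∑ p w ^ q` over the words of length `n` is comparable to `ℓ ^ (n τ(q))`, uniformly in `n`.

Since `τ 1 = 0` and `τ` is differentiable at `1`, with slope `-d` say, exponential Chebyshev bounds
make the cubes with `m(I)` far from `ℓ ^ (-n d)` carry exponentially small mass; by Borel–Cantelli
and the mass distribution principle `m` has dimension `d`. The uniform measure on the sequences of
charged letters shows in the same way that the support has dimension `τ 0`.

Convexity gives `d ≤ τ 0`. In case of equality `τ` is affine on `[0, 1]`, hence everywhere by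
analyticity, and letting `q → ±∞` every charged cube of generation `n` has mass comparable to
`ℓ ^ (-n d)`. Otherwise `τ` lies strictly above its tangent near `1`, on both sides by analyticity.
The Paley–Zygmund inequality for `m(I) ^ t` with `t` small of either sign then shows that
`m(I) ℓ ^ (n d)` is arbitrarily large, respectively small, with a probability bounded below.
By quasi-multiplicativity this happens inside every charged cube, hence infinitely often almost
surely; density theorems for Hausdorff and packing measures conclude.
-/

noncomputable section

namespace QB

/-! ### Real analysis -/

section AlmostAdditive

variable {a : ℕ → ℝ} {B : ℝ}

lemma bddBelow_div_of_almost_additive (h : ∀ n k, |a (n + k) - a n - a k| ≤ B) :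
    BddBelow (range fun n : ℕ => (a n + B) / n) := by
  have hlin : ∀ n : ℕ, n * (a 1 - B) ≤ a n + B := by
    intro n
    induction n with
    | zero => have := (abs_le.1 (h 0 0)).2; norm_num at this ⊢; linarith
    | succ n ih => have := (abs_le.1 (h n 1)).1; push_cast; linarith
  refine ⟨min (a 1 - B) 0, ?_⟩
  rintro _ ⟨n, rfl⟩
  rcases n.eq_zero_or_pos with rfl | hn
  · simp
  · exact (min_le_left _ _).trans ((le_div_iff₀' (by exact_mod_cast hn)).2 (hlin n))

/-- Fekete's lemma applies to both `a + B` and `-a + B`. -/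
lemma exists_tendsto_div_of_almost_additive (h : ∀ n k, |a (n + k) - a n - a k| ≤ B) :
    ∃ r, Tendsto (fun n => a n / n) atTop (𝓝 r) ∧ ∀ n : ℕ, |a n - n * r| ≤ B := by
  have hneg : ∀ n k, |-a (n + k) - -a n - -a k| ≤ B := fun n k => by
    rw [← abs_neg]; convert h n k using 2; ring
  have upper : Subadditive fun n => a n + B := fun n k => by linarith [(abs_le.1 (h n k)).2]
  have lower : Subadditive fun n => -a n + B := fun n k => by linarith [(abs_le.1 (h n k)).1]
  have hupper := bddBelow_div_of_almost_additive h
  have hlower := bddBelow_div_of_almost_additive (a := fun n => -a n) hneg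
  have hB := tendsto_const_div_atTop_nhds_zero_nat B
  have hlim : Tendsto (fun n => a n / n) atTop (𝓝 upper.lim) := by
    simpa [add_div] using (upper.tendsto_lim hupper).sub hB
  have hlim' : Tendsto (fun n => a n / n) atTop (𝓝 (-lower.lim)) := by
    simpa [add_div, neg_div] using ((lower.tendsto_lim hlower).sub hB).neg
  refine ⟨upper.lim, hlim, fun n => ?_⟩
  rcases n.eq_zero_or_pos with rfl | hn
  · simpa using h 0 0
  have h_upper := upper.lim_le_div hupper hn.ne'
  have h_lower := lower.lim_le_div hlower hn.ne'
  have hn' : (0 : ℝ) < n := by exact_mod_cast hn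
  rw [le_div_iff₀' hn'] at h_upper h_lower
  rw [tendsto_nhds_unique hlim hlim'] at h_upper ⊢
  exact abs_le.2 ⟨by linarith, by linarith⟩

end AlmostAdditive

lemma le_of_forall_nat_mul_le_add {x y B : ℝ} (h : ∀ n : ℕ, n * x ≤ n * y + B) : x ≤ y := by
  by_contra! hxy
  obtain ⟨n, hn⟩ := exists_nat_gt (B / (x - y))
  rw [div_lt_iff₀ (sub_pos.2 hxy)] at hn
  linarith [h n]

lemma exists_nat_mul_mem_Icc {x R : ℝ} (hx : 0 < x) (hx1 : x ≤ 1) (hR : 0 ≤ R) :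
    ∃ n : ℕ, n * x ∈ Icc R (R + 1) := by
  refine ⟨⌈R / x⌉₊, (div_le_iff₀ hx).1 (Nat.le_ceil _), ?_⟩
  calc ⌈R / x⌉₊ * x ≤ (R / x + 1) * x := by
        gcongr; exact (Nat.ceil_lt_add_one (div_nonneg hR hx.le)).le
    _ = R + x := by rw [add_mul, div_mul_cancel₀ _ hx.ne', one_mul]
    _ ≤ R + 1 := by gcongr

lemma abs_log_sum_sub_log_sum_le {ι : Type*} {s : Finset ι} (hs : s.Nonempty) {x y : ι → ℝ}
    {K : ℝ} (hx : ∀ i ∈ s, 0 < x i) (hy : ∀ i ∈ s, 0 < y i)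
    (h : ∀ i ∈ s, |Real.log (x i) - Real.log (y i)| ≤ K) :
    |Real.log (∑ i ∈ s, x i) - Real.log (∑ i ∈ s, y i)| ≤ K := by
  have key : ∀ x y : ι → ℝ, (∀ i ∈ s, 0 < x i) → (∀ i ∈ s, 0 < y i) →
      (∀ i ∈ s, Real.log (x i) - Real.log (y i) ≤ K) →
      Real.log (∑ i ∈ s, x i) - Real.log (∑ i ∈ s, y i) ≤ K := by
    intro x y hx hy h
    rw [← Real.log_div (Finset.sum_pos hx hs).ne' (Finset.sum_pos hy hs).ne',
      Real.log_le_iff_le_exp (div_pos (Finset.sum_pos hx hs) (Finset.sum_pos hy hs)),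
      div_le_iff₀ (Finset.sum_pos hy hs), Finset.mul_sum]
    refine Finset.sum_le_sum fun i hi => ?_
    rw [← div_le_iff₀ (hy i hi), ← Real.log_le_iff_le_exp (div_pos (hx i hi) (hy i hi)),
      Real.log_div (hx i hi).ne' (hy i hi).ne']
    exact h i hi
  rw [abs_sub_le_iff]
  exact ⟨key x y hx hy fun i hi => (abs_sub_le_iff.1 (h i hi)).1,
    key y x hy hx fun i hi => (abs_sub_le_iff.1 (h i hi)).2⟩

/-- The Paley–Zygmund inequality: Cauchy–Schwarz on the set `{θ ≤ Z}`. -/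
lemma sq_sub_le_sum_filter_mul_sum_sq {ι : Type*} {s : Finset ι} {p Z : ι → ℝ} {θ : ℝ}
    (hp : ∀ i ∈ s, 0 ≤ p i) (hsum : ∑ i ∈ s, p i ≤ 1) (hθ0 : 0 ≤ θ)
    (hθ : θ ≤ ∑ i ∈ s, p i * Z i) :
    (∑ i ∈ s, p i * Z i - θ) ^ 2 ≤ (∑ i ∈ s with θ ≤ Z i, p i) * ∑ i ∈ s, p i * Z i ^ 2 := by
  have hsmall : ∑ i ∈ s with ¬θ ≤ Z i, p i * Z i ≤ θ := by
    calc ∑ i ∈ s with ¬θ ≤ Z i, p i * Z i ≤ ∑ i ∈ s with ¬θ ≤ Z i, p i * θ := by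
          refine Finset.sum_le_sum fun i hi => ?_
          rw [Finset.mem_filter, not_le] at hi
          exact mul_le_mul_of_nonneg_left hi.2.le (hp i hi.1)
      _ ≤ ∑ i ∈ s, p i * θ :=
          Finset.sum_le_sum_of_subset_of_nonneg (Finset.filter_subset _ _)
            fun i hi _ => mul_nonneg (hp i hi) hθ0
      _ ≤ θ := by rw [← Finset.sum_mul]; exact mul_le_of_le_one_left hθ0 hsum
  have hlarge : ∑ i ∈ s, p i * Z i - θ ≤ ∑ i ∈ s with θ ≤ Z i, p i * Z i := by
    rw [← Finset.sum_filter_add_sum_filter_not s (fun i => θ ≤ Z i)]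
    linarith
  have hcs : (∑ i ∈ s with θ ≤ Z i, p i * Z i) ^ 2 ≤
      (∑ i ∈ s with θ ≤ Z i, p i) * ∑ i ∈ s with θ ≤ Z i, p i * Z i ^ 2 :=
    Finset.sum_sq_le_sum_mul_sum_of_sq_le_mul _ (fun i hi => hp i (Finset.mem_filter.1 hi).1)
      (fun i hi => mul_nonneg (hp i (Finset.mem_filter.1 hi).1) (sq_nonneg _))
      fun i _ => (by ring : (p i * Z i) ^ 2 = p i * (p i * Z i ^ 2)).le
  refine (pow_le_pow_left₀ (sub_nonneg.2 hθ) hlarge 2).trans (hcs.trans ?_)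
  refine mul_le_mul_of_nonneg_left ?_
    (Finset.sum_nonneg fun i hi => hp i (Finset.mem_filter.1 hi).1)
  exact Finset.sum_le_sum_of_subset_of_nonneg (Finset.filter_subset _ _)
    fun i hi _ => mul_nonneg (hp i hi) (sq_nonneg _)

lemma add_mul_sub_le_of_convexOn_of_hasDerivAt {f : ℝ → ℝ} (hf : ConvexOn ℝ univ f)
    {x f' : ℝ} (h : HasDerivAt f f' x) (y : ℝ) : f x + f' * (y - x) ≤ f y := by
  rcases lt_trichotomy x y with hxy | rfl | hxy
  · have := hf.le_slope_of_hasDerivAt (mem_univ x) (mem_univ y) hxy h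
    rw [slope_def_field, le_div_iff₀ (by linarith)] at this
    linarith
  · simp
  · have := hf.slope_le_of_hasDerivAt (mem_univ y) (mem_univ x) hxy h
    rw [slope_def_field, div_le_iff₀ (by linarith)] at this
    linarith

/-- Near `0` a nonzero analytic function is a power times a nonvanishing function. -/
lemma isBigO_comp_const_mul_of_analyticAt {𝕜 F : Type*} [NontriviallyNormedField 𝕜]
    [NormedAddCommGroup F] [NormedSpace 𝕜 F] {g : 𝕜 → F} (hg : AnalyticAt 𝕜 g 0) (c : 𝕜) :
    (fun t => g (c * t)) =O[𝓝 0] g := by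
  have hc : Tendsto (fun t : 𝕜 => c * t) (𝓝 0) (𝓝 0) := by
    simpa using (continuous_const_mul c).tendsto 0
  by_cases h : ∀ᶠ t in 𝓝 (0 : 𝕜), g t = 0
  · have h0 : (fun t => g (c * t)) =ᶠ[𝓝 0] fun _ => (0 : F) := hc.eventually h
    exact h0.trans_isBigO (Asymptotics.isBigO_zero _ _)
  obtain ⟨k, u, hu, hu0, hgu⟩ := hg.exists_eventuallyEq_pow_smul_nonzero_iff.2 h
  replace hgu : g =ᶠ[𝓝 0] fun t => t ^ k • u t := by
    simpa only [sub_zero, EventuallyEq] using hgu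
  have hpow : (fun t : 𝕜 => (c * t) ^ k) =O[𝓝 0] fun t => t ^ k := by
    simpa only [mul_pow] using Asymptotics.isBigO_const_mul_self (c ^ k) _ _
  have hunit : (fun t => u (c * t)) =O[𝓝 0] u :=
    ((hu.continuousAt.tendsto.comp hc).isBigO_one 𝕜).trans
      ((Asymptotics.isBigO_const_left_iff_pos_le_norm one_ne_zero).2 ⟨‖u 0‖ / 2, by positivity,
        (hu.continuousAt.tendsto.norm.eventually_const_le (half_lt_self (norm_pos_iff.2 hu0)))⟩)
  exact (hpow.smul hunit).congr' (hgu.comp_tendsto hc).symm hgu.symm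

/-! ### Quasi-multiplicative functions on words -/

section Words

variable {α : Type*} [Finite α]

/-- The finite set of words of length `n` over the alphabet `α`. -/
def words (α : Type*) [Finite α] (n : ℕ) : Finset (List α) := (List.finite_length_eq α n).toFinset

@[simp] lemma mem_words {n : ℕ} {w : List α} : w ∈ words α n ↔ w.length = n := by
  simp [words]

lemma sum_words_add {M : Type*} [AddCommMonoid M] (f : List α → M) (n k : ℕ) :
    ∑ w ∈ words α (n + k), f w = ∑ u ∈ words α n, ∑ v ∈ words α k, f (u ++ v) := by
  rw [← Finset.sum_product']
  refine (Finset.sum_bij (fun x _ => x.1 ++ x.2) ?_ ?_ ?_ fun _ _ => rfl).symm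
  · rintro ⟨u, v⟩ h
    simp only [Finset.mem_product, mem_words] at h
    simp [h.1, h.2]
  · rintro ⟨u, v⟩ h ⟨u', v'⟩ h' heq
    simp only [Finset.mem_product, mem_words] at h h'
    obtain ⟨hu, hv⟩ := List.append_inj heq (h.1.trans h'.1.symm)
    exact Prod.ext hu hv
  · intro w hw
    rw [mem_words] at hw
    exact ⟨(w.take n, w.drop n), by simp [hw], List.take_append_drop n w⟩

open Classical in
/-- The words of length `n` that are charged by the weight `p`. -/
def chargedWords (p : List α → ℝ) (n : ℕ) : Finset (List α) := {w ∈ words α n | p w ≠ 0}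

@[simp] lemma mem_chargedWords {p : List α → ℝ} {n : ℕ} {w : List α} :
    w ∈ chargedWords p n ↔ w.length = n ∧ p w ≠ 0 := by
  simp [chargedWords]

/-- The partition function of the weight `p`: the sum of `p w ^ q` over the words `w` of length
`n` with `p w ≠ 0`. -/
def powSum (p : List α → ℝ) (n : ℕ) (q : ℝ) : ℝ := ∑ w ∈ chargedWords p n, p w ^ q

/-- The `L^q`-spectrum of the weight `p`: the exponential growth rate, in base `b`, of its
partition function. -/
def wordSpectrum (p : List α → ℝ) (b q : ℝ) : ℝ :=
  limsup (fun n : ℕ => 1 / ((n : ℝ) * Real.log b) * Real.log (powSum p n q)) atTop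

/-- A nonnegative function on words that defines a probability on the words of each length, and
that is multiplicative up to the constant `C`. -/
structure IsQuasiMultiplicative (p : List α → ℝ) (C : ℝ) : Prop where
  one_le : 1 ≤ C
  nonneg : ∀ w, 0 ≤ p w
  nil : p [] = 1
  sum_append : ∀ (u : List α) (n : ℕ), ∑ v ∈ words α n, p (u ++ v) = p u
  lower : ∀ u v, 1 / C * (p u * p v) ≤ p (u ++ v)
  upper : ∀ u v, p (u ++ v) ≤ C * (p u * p v)

namespace IsQuasiMultiplicative

variable {p : List α → ℝ} {C b : ℝ} (hp : IsQuasiMultiplicative p C)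
include hp

lemma pos : 0 < C := zero_lt_one.trans_le hp.one_le

lemma pos_of_ne_zero {w : List α} (h : p w ≠ 0) : 0 < p w := (hp.nonneg w).lt_of_ne' h

lemma sum_words (n : ℕ) : ∑ w ∈ words α n, p w = 1 := by
  simpa [hp.nil] using hp.sum_append [] n

lemma le_one (w : List α) : p w ≤ 1 := by
  rw [← hp.sum_words w.length]
  exact Finset.single_le_sum (fun v _ => hp.nonneg v) (mem_words.2 rfl)

lemma append_ne_zero_iff (u v : List α) : p (u ++ v) ≠ 0 ↔ p u ≠ 0 ∧ p v ≠ 0 := by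
  constructor
  · contrapose!
    intro h
    have huv : p u * p v = 0 := mul_eq_zero.2 (or_iff_not_imp_left.2 h)
    exact le_antisymm (by simpa [huv] using hp.upper u v) (hp.nonneg _)
  · rintro ⟨hu, hv⟩
    have hC := hp.pos
    have hu := hp.pos_of_ne_zero hu
    have hv := hp.pos_of_ne_zero hv
    exact (lt_of_lt_of_le (by positivity) (hp.lower u v)).ne'

lemma abs_log_append_sub_le {u v : List α} (hu : p u ≠ 0) (hv : p v ≠ 0) :
    |Real.log (p (u ++ v)) - Real.log (p u * p v)| ≤ Real.log C := by
  have hC := hp.pos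
  have huv := mul_pos (hp.pos_of_ne_zero hu) (hp.pos_of_ne_zero hv)
  have happ := hp.pos_of_ne_zero ((hp.append_ne_zero_iff u v).2 ⟨hu, hv⟩)
  have lower := Real.log_le_log (by positivity) (hp.lower u v)
  have upper := Real.log_le_log happ (hp.upper u v)
  rw [Real.log_mul (by positivity) huv.ne', one_div, Real.log_inv] at lower
  rw [Real.log_mul hC.ne' huv.ne'] at upper
  exact abs_le.2 ⟨by linarith, by linarith⟩

lemma sum_chargedWords_add (f : List α → ℝ) (n k : ℕ) :
    ∑ w ∈ chargedWords p (n + k), f w =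
      ∑ x ∈ chargedWords p n ×ˢ chargedWords p k, f (x.1 ++ x.2) := by
  classical
  rw [Finset.sum_product' _ _ fun u v => f (u ++ v)]
  simp only [chargedWords, Finset.sum_filter, sum_words_add, hp.append_ne_zero_iff, ite_and]
  refine Finset.sum_congr rfl fun u _ => ?_
  split_ifs <;> simp

lemma chargedWords_nonempty (n : ℕ) : (chargedWords p n).Nonempty := by
  obtain ⟨w, hw, hpw⟩ : ∃ w ∈ words α n, p w ≠ 0 :=
    Finset.exists_ne_zero_of_sum_ne_zero (by rw [hp.sum_words]; exact one_ne_zero)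
  exact ⟨w, mem_chargedWords.2 ⟨mem_words.1 hw, hpw⟩⟩

lemma pos_of_mem_chargedWords {n : ℕ} {w : List α} (hw : w ∈ chargedWords p n) : 0 < p w :=
  hp.pos_of_ne_zero (mem_chargedWords.1 hw).2

lemma powSum_pos (n : ℕ) (q : ℝ) : 0 < powSum p n q :=
  Finset.sum_pos (fun _ hw => Real.rpow_pos_of_pos (hp.pos_of_mem_chargedWords hw) q)
    (hp.chargedWords_nonempty n)

lemma powSum_one (n : ℕ) : powSum p n 1 = 1 := by
  classical
  simp only [powSum, Real.rpow_one, chargedWords, Finset.sum_filter_ne_zero, hp.sum_words]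

omit hp in
lemma powSum_zero (p : List α → ℝ) (n : ℕ) : powSum p n 0 = (chargedWords p n).card := by
  simp [powSum]

lemma abs_log_powSum_add_sub_le (n k : ℕ) (q : ℝ) :
    |Real.log (powSum p (n + k) q) - Real.log (powSum p n q) - Real.log (powSum p k q)| ≤
      |q| * Real.log C := by
  rw [sub_sub, ← Real.log_mul (hp.powSum_pos n q).ne' (hp.powSum_pos k q).ne', powSum,
    hp.sum_chargedWords_add, powSum, powSum, Finset.sum_mul_sum, ← Finset.sum_product']
  refine abs_log_sum_sub_log_sum_le
    ((hp.chargedWords_nonempty n).product (hp.chargedWords_nonempty k)) ?_ ?_ ?_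
  all_goals
    rintro ⟨u, v⟩ huv
    obtain ⟨hu, hv⟩ := Finset.mem_product.1 huv
    replace hu := (mem_chargedWords.1 hu).2
    replace hv := (mem_chargedWords.1 hv).2
    have hpu := hp.pos_of_ne_zero hu
    have hpv := hp.pos_of_ne_zero hv
    have huv := hp.pos_of_ne_zero ((hp.append_ne_zero_iff u v).2 ⟨hu, hv⟩)
    dsimp only
  · positivity
  · positivity
  · rw [← Real.mul_rpow hpu.le hpv.le, Real.log_rpow huv, Real.log_rpow (mul_pos hpu hpv),
      ← mul_sub, abs_mul]
    exact mul_le_mul_of_nonneg_left (hp.abs_log_append_sub_le hu hv) (abs_nonneg q)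

section Spectrum

variable (hb : 1 < b)
include hb

lemma abs_log_powSum_sub_le (n : ℕ) (q : ℝ) :
    |Real.log (powSum p n q) - n * (Real.log b * wordSpectrum p b q)| ≤ |q| * Real.log C := by
  obtain ⟨r, hr, hbound⟩ := exists_tendsto_div_of_almost_additive
    (a := fun n => Real.log (powSum p n q)) fun n k => hp.abs_log_powSum_add_sub_le n k q
  have hlim : Tendsto (fun n : ℕ => 1 / ((n : ℝ) * Real.log b) * Real.log (powSum p n q)) atTop
      (𝓝 (r / Real.log b)) := by
    refine (hr.div_const (Real.log b)).congr fun n => ?_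
    rw [div_div, one_div_mul_eq_div]
  rw [wordSpectrum, hlim.limsup_eq, mul_div_cancel₀ _ (Real.log_pos hb).ne']
  exact hbound n

lemma le_powSum (n : ℕ) (q : ℝ) : C ^ (-|q|) * b ^ (n * wordSpectrum p b q) ≤ powSum p n q := by
  have h := (abs_le.1 (hp.abs_log_powSum_sub_le hb n q)).1
  rw [Real.rpow_def_of_pos hp.pos, Real.rpow_def_of_pos (zero_lt_one.trans hb), ← Real.exp_add,
    ← Real.le_log_iff_exp_le (hp.powSum_pos n q)]
  linarith

lemma powSum_le (n : ℕ) (q : ℝ) : powSum p n q ≤ C ^ |q| * b ^ (n * wordSpectrum p b q) := by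
  have h := (abs_le.1 (hp.abs_log_powSum_sub_le hb n q)).2
  rw [Real.rpow_def_of_pos hp.pos, Real.rpow_def_of_pos (zero_lt_one.trans hb), ← Real.exp_add,
    ← Real.log_le_iff_le_exp (hp.powSum_pos n q)]
  linarith

lemma wordSpectrum_one : wordSpectrum p b 1 = 0 := by
  have h : ∀ n : ℕ, |n * (Real.log b * wordSpectrum p b 1)| ≤ Real.log C := fun n => by
    simpa [hp.powSum_one] using hp.abs_log_powSum_sub_le hb n 1
  have hle : Real.log b * wordSpectrum p b 1 ≤ 0 :=
    le_of_forall_nat_mul_le_add (B := Real.log C) fun n => by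
      linarith [(abs_le.1 (h n)).2]
  have hge : 0 ≤ Real.log b * wordSpectrum p b 1 :=
    le_of_forall_nat_mul_le_add (B := Real.log C) fun n => by
      linarith [(abs_le.1 (h n)).1]
  exact (mul_eq_zero.1 (le_antisymm hle hge)).resolve_left (Real.log_pos hb).ne'

lemma card_chargedWords (n : ℕ) :
    ((chargedWords p n).card : ℝ) = b ^ (n * wordSpectrum p b 0) := by
  rw [← powSum_zero]
  exact le_antisymm (by simpa using hp.powSum_le hb n 0) (by simpa using hp.le_powSum hb n 0)

lemma wordSpectrum_nonpos {q : ℝ} (hq : 1 ≤ q) : wordSpectrum p b q ≤ 0 := by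
  refine nonpos_of_mul_nonpos_right (a := Real.log b) ?_ (Real.log_pos hb)
  refine le_of_forall_nat_mul_le_add (B := |q| * Real.log C) fun n => ?_
  have hle : powSum p n q ≤ 1 := by
    rw [← hp.powSum_one n]
    exact Finset.sum_le_sum fun w hw =>
      Real.rpow_le_rpow_of_exponent_ge (hp.pos_of_mem_chargedWords hw) (hp.le_one w) hq
  linarith [Real.log_nonpos (hp.powSum_pos n q).le hle,
    (abs_le.1 (hp.abs_log_powSum_sub_le hb n q)).1]

omit hb in
lemma powSum_convex_comb_le (n : ℕ) {a c : ℝ} (ha : 0 < a) (hc : 0 < c) (hac : a + c = 1)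
    (q r : ℝ) : powSum p n (a * q + c * r) ≤ powSum p n q ^ a * powSum p n r ^ c := by
  have holder := Real.inner_le_Lp_mul_Lq_of_nonneg (chargedWords p n)
    (Real.holderConjugate_iff.2 ⟨(one_lt_inv₀ ha).2 (by linarith), by simpa using hac⟩ :
      a⁻¹.HolderConjugate c⁻¹)
    (f := fun w => (p w ^ q) ^ a) (g := fun w => (p w ^ r) ^ c)
    (fun w _ => Real.rpow_nonneg (Real.rpow_nonneg (hp.nonneg w) q) a)
    (fun w _ => Real.rpow_nonneg (Real.rpow_nonneg (hp.nonneg w) r) c)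
  simp only [one_div, inv_inv, Real.rpow_rpow_inv (Real.rpow_nonneg (hp.nonneg _) _) ha.ne',
    Real.rpow_rpow_inv (Real.rpow_nonneg (hp.nonneg _) _) hc.ne'] at holder
  refine le_trans (Finset.sum_le_sum fun w hw => le_of_eq ?_) holder
  have hpw := hp.pos_of_mem_chargedWords hw
  rw [← Real.rpow_mul hpw.le, ← Real.rpow_mul hpw.le, ← Real.rpow_add hpw, mul_comm a, mul_comm c]

lemma convexOn_wordSpectrum : ConvexOn ℝ univ (wordSpectrum p b) := by
  refine convexOn_iff_forall_pos.2 ⟨convex_univ, fun q _ r _ a c ha hc hac => ?_⟩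
  simp only [smul_eq_mul]
  refine le_of_mul_le_mul_left (a := Real.log b) ?_ (Real.log_pos hb)
  refine le_of_forall_nat_mul_le_add
    (B := (|a * q + c * r| + a * |q| + c * |r|) * Real.log C) fun n => ?_
  have hq := hp.powSum_pos n q
  have hr := hp.powSum_pos n r
  have hlog := Real.log_le_log (hp.powSum_pos n _) (hp.powSum_convex_comb_le n ha hc hac q r)
  rw [Real.log_mul (Real.rpow_pos_of_pos hq a).ne' (Real.rpow_pos_of_pos hr c).ne',
    Real.log_rpow hq, Real.log_rpow hr] at hlog
  have hcomb := (abs_le.1 (hp.abs_log_powSum_sub_le hb n (a * q + c * r))).1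
  have hq' := mul_le_mul_of_nonneg_left (abs_le.1 (hp.abs_log_powSum_sub_le hb n q)).2 ha.le
  have hr' := mul_le_mul_of_nonneg_left (abs_le.1 (hp.abs_log_powSum_sub_le hb n r)).2 hc.le
  linarith

lemma mul_log_le (w : List α) (hw : p w ≠ 0) (q : ℝ) :
    q * Real.log (p w) ≤ w.length * (Real.log b * wordSpectrum p b q) + |q| * Real.log C := by
  have hpw := hp.pos_of_ne_zero hw
  have hle : p w ^ q ≤ powSum p w.length q :=
    Finset.single_le_sum (f := fun v => p v ^ q) (fun v _ => Real.rpow_nonneg (hp.nonneg v) q)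
      (mem_chargedWords.2 ⟨rfl, hw⟩)
  rw [← Real.log_rpow hpw]
  linarith [Real.log_le_log (Real.rpow_pos_of_pos hpw q) hle,
    (abs_le.1 (hp.abs_log_powSum_sub_le hb w.length q)).2]

/-- Compare `p w ^ q` with the partition function and let `q → ±∞`. -/
lemma abs_log_add_le_of_affine {δ : ℝ} (hτ : ∀ q, wordSpectrum p b q = δ * (1 - q)) {w : List α}
    (hw : p w ≠ 0) : |Real.log (p w) + w.length * δ * Real.log b| ≤ Real.log C := by
  refine abs_le.2 ⟨le_of_forall_nat_mul_le_add (B := w.length * δ * Real.log b) fun n => ?_,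
    le_of_forall_nat_mul_le_add (B := w.length * δ * Real.log b) fun n => ?_⟩
  · have h := hp.mul_log_le hb w hw (-n)
    rw [hτ, abs_neg, Nat.abs_cast] at h
    linarith
  · have h := hp.mul_log_le hb w hw n
    rw [hτ, Nat.abs_cast] at h
    linarith

lemma le_of_affine {δ : ℝ} (hτ : ∀ q, wordSpectrum p b q = δ * (1 - q)) (w : List α) :
    p w ≤ C * b ^ (-(w.length * δ)) := by
  have hb0 : 0 < b := zero_lt_one.trans hb
  by_cases hw : p w = 0
  · rw [hw]; exact mul_nonneg hp.pos.le (Real.rpow_nonneg hb0.le _)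
  have h := (abs_le.1 (hp.abs_log_add_le_of_affine hb hτ hw)).2
  nth_rw 1 [Real.rpow_def_of_pos hb0, ← Real.exp_log hp.pos]
  rw [← Real.exp_add, ← Real.log_le_iff_le_exp (hp.pos_of_ne_zero hw)]
  linarith

lemma ge_of_affine {δ : ℝ} (hτ : ∀ q, wordSpectrum p b q = δ * (1 - q)) {w : List α}
    (hw : p w ≠ 0) : b ^ (-(w.length * δ)) ≤ C * p w := by
  have h := (abs_le.1 (hp.abs_log_add_le_of_affine hb hτ hw)).1
  rw [Real.rpow_def_of_pos (zero_lt_one.trans hb),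
    ← Real.le_log_iff_exp_le (mul_pos hp.pos (hp.pos_of_ne_zero hw)),
    Real.log_mul hp.pos.ne' hw]
  linarith

end Spectrum

end IsQuasiMultiplicative

end Words

/-! ### Deviations of the weight from its typical size -/

section Words

variable {α : Type*} [Finite α]

namespace IsQuasiMultiplicative

variable {p : List α → ℝ} {C b d : ℝ} (hp : IsQuasiMultiplicative p C) (hb : 1 < b)
include hp hb

section Tangent

variable (hd : HasDerivAt (wordSpectrum p b) (-d) 1)
include hd

lemma mul_one_sub_le_wordSpectrum (q : ℝ) : d * (1 - q) ≤ wordSpectrum p b q := by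
  have := add_mul_sub_le_of_convexOn_of_hasDerivAt (hp.convexOn_wordSpectrum hb) hd q
  rw [hp.wordSpectrum_one hb] at this
  linarith

lemma neg_deriv_nonneg : 0 ≤ d := by
  linarith [hp.mul_one_sub_le_wordSpectrum hb hd 2, hp.wordSpectrum_nonpos hb one_le_two]

lemma neg_deriv_le_wordSpectrum_zero : d ≤ wordSpectrum p b 0 := by
  linarith [hp.mul_one_sub_le_wordSpectrum hb hd 0]

/-- A convex function that meets its tangent at `1` again at `0` is affine on `[0, 1]`; by
analyticity it is affine everywhere. -/
lemma wordSpectrum_eq_of_neg_deriv_eq (hτ : AnalyticOnNhd ℝ (wordSpectrum p b) univ)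
    (h : d = wordSpectrum p b 0) (q : ℝ) : wordSpectrum p b q = d * (1 - q) := by
  have hIcc : ∀ q ∈ Icc (0 : ℝ) 1, wordSpectrum p b q = d * (1 - q) := by
    intro q hq
    refine le_antisymm ?_ (hp.mul_one_sub_le_wordSpectrum hb hd q)
    have := (hp.convexOn_wordSpectrum hb).2 (mem_univ 0) (mem_univ 1) (sub_nonneg.2 hq.2) hq.1
      (sub_add_cancel 1 q)
    simp only [smul_eq_mul, mul_zero, mul_one, zero_add, hp.wordSpectrum_one hb, ← h,
      add_zero] at this
    linarith
  have heq : wordSpectrum p b =ᶠ[𝓝 (1 / 2)] fun q : ℝ => d * (1 - q) :=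
    eventually_of_mem (Icc_mem_nhds (by norm_num) (by norm_num)) hIcc
  exact congrFun (hτ.eq_of_eventuallyEq (fun x _ => by fun_prop) heq) q

/-- By analyticity, the gap between the spectrum and its tangent at `1` does not vanish near `1`
and is doubling there. -/
lemma exists_doubling_of_lt (hτ : AnalyticOnNhd ℝ (wordSpectrum p b) univ)
    (h : d < wordSpectrum p b 0) :
    ∃ M, 0 ≤ M ∧ ∀ᶠ t in 𝓝[≠] (0 : ℝ), 0 < d * t + wordSpectrum p b (1 + t) ∧
      d * (2 * t) + wordSpectrum p b (1 + 2 * t) ≤ M * (d * t + wordSpectrum p b (1 + t)) := by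
  set φ : ℝ → ℝ := fun t => d * t + wordSpectrum p b (1 + t) with hφ
  have hana : AnalyticOnNhd ℝ φ univ := fun t _ => by
    have hcomp : AnalyticAt ℝ (fun t => wordSpectrum p b (1 + t)) t :=
      (hτ (1 + t) (mem_univ _)).comp (f := fun t => 1 + t) (by fun_prop)
    fun_prop
  have hnonneg : ∀ t, 0 ≤ φ t := fun t => by
    have := hp.mul_one_sub_le_wordSpectrum hb hd (1 + t)
    simp only [hφ]
    linarith
  have hne : ∀ᶠ t in 𝓝[≠] (0 : ℝ), φ t ≠ 0 := by
    refine (hana 0 (mem_univ _)).eventually_eq_zero_or_eventually_ne_zero.resolve_left fun h0 => ?_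
    have := congrFun
      (hana.eq_of_eventuallyEq (g := fun _ => 0) (fun _ _ => analyticAt_const) h0) (-1)
    simp only [hφ, add_neg_cancel] at this
    linarith
  obtain ⟨M, hM, hbound⟩ :=
    (isBigO_comp_const_mul_of_analyticAt (hana 0 (mem_univ _)) 2).exists_nonneg
  refine ⟨M, hM, ?_⟩
  filter_upwards [hne, eventually_nhdsWithin_of_eventually_nhds hbound.bound] with t ht hMt
  rw [Real.norm_of_nonneg (hnonneg _), Real.norm_of_nonneg (hnonneg _)] at hMt
  exact ⟨(hnonneg t).lt_of_ne' ht, hMt⟩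

end Tangent

lemma sum_mul_rpow_eq (n : ℕ) (s t : ℝ) :
    ∑ w ∈ words α n, p w * (p w * b ^ (n * s)) ^ t = b ^ (n * (s * t)) * powSum p n (1 + t) := by
  classical
  have hb0 : 0 < b := zero_lt_one.trans hb
  rw [powSum, Finset.mul_sum, chargedWords, Finset.sum_filter]
  refine Finset.sum_congr rfl fun w _ => ?_
  split_ifs with hw
  · have hpw := hp.pos_of_ne_zero hw
    rw [Real.mul_rpow hpw.le (Real.rpow_nonneg hb0.le _), ← Real.rpow_mul hb0.le,
      Real.rpow_add hpw, Real.rpow_one, mul_assoc (n : ℝ)]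
    ring
  · rw [not_not.1 hw, zero_mul]

lemma sum_mul_rpow_le (n : ℕ) (s t : ℝ) :
    ∑ w ∈ words α n, p w * (p w * b ^ (n * s)) ^ t ≤
      C ^ |1 + t| * b ^ (n * (s * t + wordSpectrum p b (1 + t))) := by
  rw [hp.sum_mul_rpow_eq hb, mul_add (n : ℝ), Real.rpow_add (zero_lt_one.trans hb),
    mul_left_comm (C ^ _)]
  exact mul_le_mul_of_nonneg_left (hp.powSum_le hb n (1 + t))
    (Real.rpow_nonneg (zero_lt_one.trans hb).le _)

lemma le_sum_mul_rpow (n : ℕ) (s t : ℝ) :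
    C ^ (-|1 + t|) * b ^ (n * (s * t + wordSpectrum p b (1 + t))) ≤
      ∑ w ∈ words α n, p w * (p w * b ^ (n * s)) ^ t := by
  rw [hp.sum_mul_rpow_eq hb, mul_add (n : ℝ), Real.rpow_add (zero_lt_one.trans hb),
    mul_left_comm (C ^ _)]
  exact mul_le_mul_of_nonneg_left (hp.le_powSum hb n (1 + t))
    (Real.rpow_nonneg (zero_lt_one.trans hb).le _)

lemma mul_rpow_nonneg (w : List α) (x : ℝ) : 0 ≤ p w * b ^ x :=
  mul_nonneg (hp.nonneg w) (Real.rpow_nonneg (zero_lt_one.trans hb).le _)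

/-! #### Exponentially rare deviations -/

lemma sum_filter_one_le_rpow_le (n : ℕ) (s t : ℝ) :
    ∑ w ∈ words α n with 1 ≤ (p w * b ^ (n * s)) ^ t, p w ≤
      C ^ |1 + t| * (b ^ (s * t + wordSpectrum p b (1 + t))) ^ n := by
  calc ∑ w ∈ words α n with 1 ≤ (p w * b ^ (n * s)) ^ t, p w
      ≤ ∑ w ∈ words α n with 1 ≤ (p w * b ^ (n * s)) ^ t, p w * (p w * b ^ (n * s)) ^ t :=
        Finset.sum_le_sum fun w hw =>
          le_mul_of_one_le_right (hp.nonneg w) (Finset.mem_filter.1 hw).2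
    _ ≤ ∑ w ∈ words α n, p w * (p w * b ^ (n * s)) ^ t :=
        Finset.sum_le_sum_of_subset_of_nonneg (Finset.filter_subset _ _) fun w _ _ =>
          mul_nonneg (hp.nonneg w) (Real.rpow_nonneg (hp.mul_rpow_nonneg hb w _) _)
    _ ≤ C ^ |1 + t| * b ^ (n * (s * t + wordSpectrum p b (1 + t))) := hp.sum_mul_rpow_le hb n s t
    _ = C ^ |1 + t| * (b ^ (s * t + wordSpectrum p b (1 + t))) ^ n := by
        rw [← Real.rpow_natCast, ← Real.rpow_mul (zero_lt_one.trans hb).le, mul_comm (n : ℝ)]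

omit hp hb in
lemma deriv_mul_add_wordSpectrum (hd : HasDerivAt (wordSpectrum p b) (-d) 1) (s : ℝ) :
    deriv (fun t => s * t + wordSpectrum p b (1 + t)) 0 = s - d := by
  have hshift : HasDerivAt (fun t => wordSpectrum p b (1 + t)) (-d) 0 := by
    simpa using HasDerivAt.comp_const_add 1 0 (by simpa using hd)
  simpa [sub_eq_add_neg] using (((hasDerivAt_id' (0 : ℝ)).const_mul s).fun_add hshift).deriv

lemma exists_sum_filter_ge_le (hd : HasDerivAt (wordSpectrum p b) (-d) 1) {s : ℝ} (hsd : s < d) :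
    ∃ A ρ : ℝ, 0 ≤ ρ ∧ ρ < 1 ∧ ∀ n : ℕ,
      ∑ w ∈ words α n with b ^ (-(n * s)) ≤ p w, p w ≤ A * ρ ^ n := by
  have hb0 : 0 < b := zero_lt_one.trans hb
  have hsign := eventually_nhdsWithin_sign_eq_of_deriv_neg
    ((deriv_mul_add_wordSpectrum hd s).trans_lt (sub_neg.2 hsd)) (by simp [hp.wordSpectrum_one hb])
  obtain ⟨t, hlt, ht : 0 < t⟩ := ((hsign.filter_mono nhdsWithin_le_nhds).and
    (self_mem_nhdsWithin : Ioi (0 : ℝ) ∈ 𝓝[>] 0)).exists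
  rw [zero_sub, Left.sign_neg, sign_pos ht, sign_eq_neg_one_iff] at hlt
  refine ⟨C ^ |1 + t|, b ^ (s * t + wordSpectrum p b (1 + t)), Real.rpow_nonneg hb0.le _,
    Real.rpow_lt_one_of_one_lt_of_neg hb hlt, fun n => ?_⟩
  refine le_trans (Finset.sum_le_sum_of_subset_of_nonneg ?_ fun w _ _ => hp.nonneg w)
    (hp.sum_filter_one_le_rpow_le hb n s t)
  refine Finset.monotone_filter_right _ fun w _ hw => Real.one_le_rpow ?_ ht.le
  rwa [Real.rpow_neg hb0.le, inv_le_iff_one_le_mul₀ (Real.rpow_pos_of_pos hb0 _)] at hw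

lemma exists_sum_filter_le_le (hd : HasDerivAt (wordSpectrum p b) (-d) 1) {s : ℝ} (hsd : d < s) :
    ∃ A ρ : ℝ, 0 ≤ ρ ∧ ρ < 1 ∧ ∀ n : ℕ,
      ∑ w ∈ words α n with p w ≤ b ^ (-(n * s)), p w ≤ A * ρ ^ n := by
  have hb0 : 0 < b := zero_lt_one.trans hb
  have hsign := eventually_nhdsWithin_sign_eq_of_deriv_pos
    ((sub_pos.2 hsd).trans_eq (deriv_mul_add_wordSpectrum hd s).symm)
    (by simp [hp.wordSpectrum_one hb])
  obtain ⟨t, hlt, ht : t < 0⟩ := ((hsign.filter_mono nhdsWithin_le_nhds).and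
    (self_mem_nhdsWithin : Iio (0 : ℝ) ∈ 𝓝[<] 0)).exists
  rw [sub_zero, sign_neg ht, sign_eq_neg_one_iff] at hlt
  refine ⟨C ^ |1 + t|, b ^ (s * t + wordSpectrum p b (1 + t)), Real.rpow_nonneg hb0.le _,
    Real.rpow_lt_one_of_one_lt_of_neg hb hlt, fun n => ?_⟩
  refine le_trans ?_ (hp.sum_filter_one_le_rpow_le hb n s t)
  rw [← Finset.sum_filter_ne_zero, Finset.filter_filter]
  refine Finset.sum_le_sum_of_subset_of_nonneg ?_ fun w _ _ => hp.nonneg w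
  refine Finset.monotone_filter_right _ fun w _ hw => ?_
  refine Real.one_le_rpow_of_pos_of_le_one_of_nonpos
    (mul_pos (hp.pos_of_ne_zero hw.2) (Real.rpow_pos_of_pos hb0 _)) ?_ ht.le
  rw [← le_div_iff₀ (Real.rpow_pos_of_pos hb0 _), one_div, ← Real.rpow_neg hb0.le]
  exact hw.1

/-! #### Deviations of fixed probability -/

/-- If `φ (2 t) ≤ M φ t` for `φ t = d t + τ (1 + t)`, then at the generations `n` with `n φ t`
close to `R` the second moment of `(p w * b ^ (n d)) ^ t` is comparable with the square of the
first, and the Paley–Zygmund inequality applies. -/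
lemma one_div_le_sum_filter_two_le_rpow {M R t : ℝ} (hM : 0 ≤ M) (hR : b ^ R = 3 * C ^ (2 : ℝ))
    (ht : |t| ≤ 1 / 2) {n : ℕ} (hn : n * (d * t + wordSpectrum p b (1 + t)) ∈ Icc R (R + 1))
    (hdouble : d * (2 * t) + wordSpectrum p b (1 + 2 * t) ≤
      M * (d * t + wordSpectrum p b (1 + t))) :
    1 / (C ^ (2 : ℝ) * b ^ (M * (R + 1))) ≤
      ∑ w ∈ words α n with 2 ≤ (p w * b ^ (n * d)) ^ t, p w := by
  have hC2 : 0 < C ^ (2 : ℝ) := Real.rpow_pos_of_pos hp.pos _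
  have hbn : ∀ x : ℝ, 0 < b ^ x := Real.rpow_pos_of_pos (zero_lt_one.trans hb)
  obtain ⟨ht_lower, ht_upper⟩ := abs_le.1 ht
  have first_moment : 3 ≤ ∑ w ∈ words α n, p w * (p w * b ^ (n * d)) ^ t := by
    have hexp : |1 + t| ≤ 2 := abs_le.2 ⟨by linarith, by linarith⟩
    calc (3 : ℝ) = C ^ (-(2 : ℝ)) * b ^ R := by rw [hR, Real.rpow_neg hp.pos.le]; field_simp
      _ ≤ C ^ (-|1 + t|) * b ^ (n * (d * t + wordSpectrum p b (1 + t))) :=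
        mul_le_mul (Real.rpow_le_rpow_of_exponent_le hp.one_le (neg_le_neg hexp))
          (Real.rpow_le_rpow_of_exponent_le hb.le hn.1) (hbn _).le
          (Real.rpow_pos_of_pos hp.pos _).le
      _ ≤ _ := hp.le_sum_mul_rpow hb n d t
  have second_moment : ∑ w ∈ words α n, p w * ((p w * b ^ (n * d)) ^ t) ^ 2 ≤
      C ^ (2 : ℝ) * b ^ (M * (R + 1)) := by
    have hexp : |1 + 2 * t| ≤ 2 := abs_le.2 ⟨by linarith, by linarith⟩
    have hgap : n * (d * (2 * t) + wordSpectrum p b (1 + 2 * t)) ≤ M * (R + 1) :=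
      calc _ ≤ n * (M * (d * t + wordSpectrum p b (1 + t))) := by gcongr
        _ = M * (n * (d * t + wordSpectrum p b (1 + t))) := mul_left_comm ..
        _ ≤ M * (R + 1) := mul_le_mul_of_nonneg_left hn.2 hM
    simp only [← Real.rpow_mul_natCast (hp.mul_rpow_nonneg hb _ _), Nat.cast_ofNat, mul_comm t 2]
    exact (hp.sum_mul_rpow_le hb n d (2 * t)).trans <|
      mul_le_mul (Real.rpow_le_rpow_of_exponent_le hp.one_le hexp)
        (Real.rpow_le_rpow_of_exponent_le hb.le hgap) (hbn _).le hC2.le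
  have paley_zygmund := sq_sub_le_sum_filter_mul_sum_sq (Z := fun w => (p w * b ^ (n * d)) ^ t)
    (fun w _ => hp.nonneg w) (hp.sum_words n).le zero_le_two (by linarith)
  rw [div_le_iff₀ (mul_pos hC2 (hbn _))]
  calc (1 : ℝ) ≤ (∑ w ∈ words α n, p w * (p w * b ^ (n * d)) ^ t - 2) ^ 2 := by nlinarith
    _ ≤ _ := paley_zygmund
    _ ≤ _ := mul_le_mul_of_nonneg_left second_moment (Finset.sum_nonneg fun w _ => hp.nonneg w)

lemma exists_le_sum_filter_two_le_rpow (hd : HasDerivAt (wordSpectrum p b) (-d) 1)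
    (hτ : AnalyticOnNhd ℝ (wordSpectrum p b) univ) (h : d < wordSpectrum p b 0) :
    ∃ c > 0, ∀ N : ℕ, ∀ᶠ t in 𝓝[≠] (0 : ℝ), ∃ n ≥ N,
      c ≤ ∑ w ∈ words α n with 2 ≤ (p w * b ^ (n * d)) ^ t, p w := by
  have hb0 : 0 < b := zero_lt_one.trans hb
  have hC2 : 1 ≤ C ^ (2 : ℝ) := Real.one_le_rpow hp.one_le zero_le_two
  obtain ⟨M, hM, hdouble⟩ := hp.exists_doubling_of_lt hb hd hτ h
  set R : ℝ := Real.logb b (3 * C ^ (2 : ℝ))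
  have hR : b ^ R = 3 * C ^ (2 : ℝ) := Real.rpow_logb hb0 hb.ne' (by positivity)
  have hR0 : 0 < R := Real.logb_pos hb (by linarith)
  refine ⟨1 / (C ^ (2 : ℝ) * b ^ (M * (R + 1))),
    one_div_pos.2 (mul_pos (by positivity) (Real.rpow_pos_of_pos hb0 _)), fun N => ?_⟩
  have hlim : Tendsto (fun t => d * t + wordSpectrum p b (1 + t)) (𝓝[≠] 0) (𝓝 0) := by
    have hcont : ContinuousAt (fun t => d * t + wordSpectrum p b (1 + t)) 0 := by
      have : ContinuousAt (wordSpectrum p b) (1 + 0) := (hτ _ (mem_univ _)).continuousAt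
      fun_prop
    simpa [hp.wordSpectrum_one hb] using hcont.tendsto.mono_left nhdsWithin_le_nhds
  have hsmall : ∀ᶠ t in 𝓝[≠] (0 : ℝ), |t| ≤ 1 / 2 :=
    nhdsWithin_le_nhds
      ((continuous_abs.tendsto' 0 0 abs_zero).eventually_le_const one_half_pos)
  filter_upwards [hsmall, hdouble, hlim.eventually_le_const one_pos,
    hlim.eventually_lt_const (div_pos hR0 N.cast_add_one_pos)] with t ht htM ht1 htN
  obtain ⟨n, hn⟩ := exists_nat_mul_mem_Icc htM.1 ht1 hR0.le
  refine ⟨n, ?_, hp.one_div_le_sum_filter_two_le_rpow hb hM hR ht hn htM.2⟩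
  rw [lt_div_iff₀ N.cast_add_one_pos] at htN
  have : (N : ℝ) + 1 < n + 1 := by nlinarith [hn.1, htM.1]
  exact_mod_cast (add_lt_add_iff_right 1).1 this |>.le

omit hp hb in
lemma eventually_rpow_lt_two {K : ℝ} (hK : 0 < K) : ∀ᶠ t in 𝓝 (0 : ℝ), K ^ t < 2 :=
  (Real.continuousAt_const_rpow hK.ne').eventually_lt_const (by simp)

lemma exists_le_sum_filter_ge (hd : HasDerivAt (wordSpectrum p b) (-d) 1)
    (hτ : AnalyticOnNhd ℝ (wordSpectrum p b) univ) (h : d < wordSpectrum p b 0) :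
    ∃ c > 0, ∀ K > 0, ∀ N : ℕ, ∃ n ≥ N,
      c ≤ ∑ w ∈ words α n with K * b ^ (-(n * d)) ≤ p w, p w := by
  have hb0 : 0 < b := zero_lt_one.trans hb
  obtain ⟨c, hc, H⟩ := hp.exists_le_sum_filter_two_le_rpow hb hd hτ h
  refine ⟨c, hc, fun K hK N => ?_⟩
  obtain ⟨t, ⟨⟨n, hn, hle⟩, hKt⟩, ht⟩ := (((H N).filter_mono (nhdsGT_le_nhdsNE 0)).and
    (nhdsWithin_le_nhds (eventually_rpow_lt_two hK)) |>.and self_mem_nhdsWithin).exists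
  refine ⟨n, hn, hle.trans (Finset.sum_le_sum_of_subset_of_nonneg ?_ fun w _ _ => hp.nonneg w)⟩
  refine Finset.monotone_filter_right _ fun w _ hw => ?_
  rw [Real.rpow_neg hb0.le, ← div_eq_mul_inv, div_le_iff₀ (Real.rpow_pos_of_pos hb0 _)]
  exact (Real.rpow_le_rpow_iff hK.le (hp.mul_rpow_nonneg hb w _) ht).1 (hKt.le.trans hw)

lemma exists_le_sum_filter_le (hd : HasDerivAt (wordSpectrum p b) (-d) 1)
    (hτ : AnalyticOnNhd ℝ (wordSpectrum p b) univ) (h : d < wordSpectrum p b 0) :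
    ∃ c > 0, ∀ K > 0, ∀ N : ℕ, ∃ n ≥ N,
      c ≤ ∑ w ∈ words α n with p w ≤ K * b ^ (-(n * d)), p w := by
  have hb0 : 0 < b := zero_lt_one.trans hb
  obtain ⟨c, hc, H⟩ := hp.exists_le_sum_filter_two_le_rpow hb hd hτ h
  refine ⟨c, hc, fun K hK N => ?_⟩
  obtain ⟨t, ⟨⟨n, hn, hle⟩, hKt⟩, ht⟩ := (((H N).filter_mono (nhdsLT_le_nhdsNE 0)).and
    (nhdsWithin_le_nhds (eventually_rpow_lt_two hK)) |>.and self_mem_nhdsWithin).exists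
  refine ⟨n, hn, hle.trans (Finset.sum_le_sum_of_subset_of_nonneg ?_ fun w _ _ => hp.nonneg w)⟩
  refine Finset.monotone_filter_right _ fun w _ hw => ?_
  rw [Real.rpow_neg hb0.le, ← div_eq_mul_inv, le_div_iff₀ (Real.rpow_pos_of_pos hb0 _)]
  by_contra! hlt
  exact absurd (hw.trans (Real.rpow_lt_rpow_of_neg hK hlt ht).le) (not_le.2 hKt)

end IsQuasiMultiplicative

end Words

/-! ### Comparison of measures -/

section Comparison

variable {X : Type*} [MeasurableSpace X] {μ ν : Measure X}

lemma le_measure_limsup [IsFiniteMeasure μ] {G : ℕ → Set X} (hG : ∀ n, MeasurableSet (G n))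
    {c : ℝ≥0∞} (h : ∃ᶠ n in atTop, c ≤ μ (G n)) : c ≤ μ (limsup G atTop) := by
  simp only [limsup_eq_iInf_iSup_of_nat, iInf_eq_iInter, iSup_eq_iUnion]
  have hmeas : ∀ N, MeasurableSet (⋃ n ≥ N, G n) := fun N =>
    MeasurableSet.iUnion fun n => MeasurableSet.iUnion fun _ => hG n
  have hanti : Antitone fun N => ⋃ n ≥ N, G n := fun N N' hN =>
    biUnion_mono (fun _ hn => hN.trans hn) fun _ _ => subset_rfl
  refine ge_of_tendsto' (tendsto_measure_iInter_atTop (fun N => (hmeas N).nullMeasurableSet) hanti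
    ⟨0, measure_ne_top _ _⟩) fun N => ?_
  obtain ⟨n, hn, hc⟩ := frequently_atTop.1 h N
  exact hc.trans (measure_mono (subset_iUnion₂_of_subset n hn subset_rfl))

lemma le_of_forall_isOpen [TopologicalSpace X] [ν.OuterRegular]
    (h : ∀ U, IsOpen U → μ U ≤ ν U) : μ ≤ ν := by
  intro A
  rw [A.measure_eq_iInf_isOpen ν]
  exact le_iInf₂ fun U hAU => le_iInf fun hU => (measure_mono hAU).trans (h U hU)

lemma stronglyEquivalent_of_le_smul {D : ℕ} {μ ν : Measure (E D)} {K K' : ℝ≥0}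
    (hμ : μ ≤ K • ν) (hν : ν ≤ K' • μ) : StronglyEquivalent μ ν := by
  have hC : 1 ≤ max 1 (max K K') := le_max_left _ _
  have hK : K ≤ max 1 (max K K') := (le_max_left _ _).trans (le_max_right _ _)
  have hK' : K' ≤ max 1 (max K K') := (le_max_right _ _).trans (le_max_right _ _)
  refine ⟨max 1 (max K K'), hC, fun A _ => ⟨?_, (hμ A).trans ?_⟩⟩
  · rw [ENNReal.inv_mul_le_iff (ENNReal.coe_ne_zero.2 (one_pos.trans_le hC).ne')
      ENNReal.coe_ne_top]
    exact (hν A).trans (mul_le_mul_left (ENNReal.coe_le_coe.2 hK') _)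
  · exact mul_le_mul_left (ENNReal.coe_le_coe.2 hK) _

lemma lowerDim_le_upperDim {D : ℕ} (m : Measure (E D)) : lowerDim m ≤ upperDim m :=
  le_iInf₂ fun A hA => le_iInf fun h1 => iInf_le_of_le A <| iInf₂_le_of_le hA (by simp [h1]) le_rfl

end Comparison

/-! ### Hausdorff measures along the scales `b ^ (-n)` -/

section MassDistribution

lemma inv_pow_rpow_eq {b : ℝ} (hb : 0 ≤ b) (n : ℕ) (s : ℝ) :
    ((b ^ n)⁻¹) ^ s = b ^ (-(n * s)) := by
  rw [Real.inv_rpow (by positivity), ← Real.rpow_natCast, ← Real.rpow_mul hb, Real.rpow_neg hb]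

lemma rpow_neg_add_mul {b : ℝ} (hb : 0 < b) (k n : ℕ) (s : ℝ) :
    b ^ (-((k + n : ℕ) * s)) = b ^ (-(k * s)) * b ^ (-(n * s)) := by
  rw [← Real.rpow_add hb, Nat.cast_add, add_mul, neg_add]

lemma exists_nat_le_inv_pow_le_mul {b r : ℝ} (hb : 1 < b) (hr : 0 < r) {N : ℕ}
    (hrN : r ≤ (b ^ N)⁻¹) : ∃ n ≥ N, r ≤ (b ^ n)⁻¹ ∧ (b ^ n)⁻¹ ≤ b * r := by
  have : 0 < b := one_pos.trans hb
  obtain ⟨n, hn, hrn⟩ := exists_nat_pow_near ((one_le_pow₀ hb.le).trans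
    ((le_inv_comm₀ (by positivity) hr).2 hrN)) hb
  refine ⟨n, ?_, (le_inv_comm₀ hr (by positivity)).2 hn, ?_⟩
  · have : b ^ N < b ^ (n + 1) := ((le_inv_comm₀ (by positivity) hr).2 hrN).trans_lt hrn
    exact Nat.lt_succ_iff.1 ((pow_lt_pow_iff_right₀ hb).1 this)
  · have : r⁻¹ * r ≤ b ^ (n + 1) * r := mul_le_mul_of_nonneg_right hrn.le hr.le
    rw [inv_mul_cancel₀ hr.ne', pow_succ, mul_assoc] at this
    exact inv_le_of_inv_le₀ (by positivity) ((inv_le_iff_one_le_mul₀ (by positivity)).2 this)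

variable {X : Type*} [EMetricSpace X] [MeasurableSpace X] {μ : Measure X} {b s A : ℝ}

lemma measure_le_mul_ediam_rpow (hb : 1 < b) (hs : 0 ≤ s) (hA : 0 ≤ A) {N : ℕ} {U : Set X}
    (h : ∀ n ≥ N, Metric.ediam U ≤ ENNReal.ofReal (b ^ n)⁻¹ →
      μ U ≤ ENNReal.ofReal (A * b ^ (-(n * s))))
    (hU : Metric.ediam U < ENNReal.ofReal (b ^ N)⁻¹) :
    μ U ≤ ENNReal.ofReal (A * b ^ s) * Metric.ediam U ^ s := by
  have hb0 : 0 < b := one_pos.trans hb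
  have key : ∀ t ∈ Ioo (Metric.ediam U) (ENNReal.ofReal (b ^ N)⁻¹),
      μ U ≤ ENNReal.ofReal (A * b ^ s) * t ^ s := by
    rintro t ⟨htU, htN⟩
    lift t to ℝ≥0 using ne_top_of_lt htN
    have ht0 : (0 : ℝ) < t := NNReal.coe_pos.2 (ENNReal.coe_pos.1 (pos_of_gt htU))
    rw [← ENNReal.ofReal_coe_nnreal] at htU htN ⊢
    obtain ⟨n, hNn, htn, hnt⟩ := exists_nat_le_inv_pow_le_mul hb ht0
      ((ENNReal.ofReal_le_ofReal_iff (by positivity)).1 htN.le)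
    refine (h n hNn (htU.le.trans (ENNReal.ofReal_le_ofReal htn))).trans ?_
    rw [ENNReal.ofReal_rpow_of_pos ht0, ← ENNReal.ofReal_mul (by positivity), mul_assoc,
      ← Real.mul_rpow hb0.le ht0.le, ← inv_pow_rpow_eq hb0.le]
    gcongr
  have hlim : Tendsto (fun t => ENNReal.ofReal (A * b ^ s) * t ^ s) (𝓝[>] Metric.ediam U)
      (𝓝 (ENNReal.ofReal (A * b ^ s) * Metric.ediam U ^ s)) :=
    (ENNReal.Tendsto.const_mul ((ENNReal.continuous_rpow_const (y := s)).tendsto _)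
      (Or.inr ENNReal.ofReal_ne_top)).mono_left nhdsWithin_le_nhds
  have : (𝓝[>] Metric.ediam U).NeBot := nhdsGT_neBot_of_exists_gt ⟨_, hU⟩
  exact ge_of_tendsto hlim (eventually_of_mem (Ioo_mem_nhdsGT hU) key)

lemma measure_le_mul_hausdorffMeasure [BorelSpace X] (hb : 1 < b) (hs : 0 ≤ s) (hA : 0 < A)
    {N : ℕ} {S : Set X}
    (h : ∀ n ≥ N, ∀ U ⊆ S, Metric.ediam U ≤ ENNReal.ofReal (b ^ n)⁻¹ →
      μ U ≤ ENNReal.ofReal (A * b ^ (-(n * s)))) :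
    μ S ≤ ENNReal.ofReal (A * b ^ s) * μH[s] S := by
  have hK : ENNReal.ofReal (A * b ^ s) ≠ 0 := (ENNReal.ofReal_pos.2 (by positivity)).ne'
  have hscale : ENNReal.ofReal (b ^ (N + 1))⁻¹ < ENNReal.ofReal (b ^ N)⁻¹ :=
    (ENNReal.ofReal_lt_ofReal_iff (by positivity)).2
      (inv_strictAnti₀ (by positivity) (pow_lt_pow_right₀ hb N.lt_succ_self))
  rw [← ENNReal.inv_mul_le_iff hK ENNReal.ofReal_ne_top, hausdorffMeasure_apply]
  refine le_iSup₂_of_le (ENNReal.ofReal (b ^ (N + 1))⁻¹) (ENNReal.ofReal_pos.2 (by positivity))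
    (le_iInf₂ fun t hSt => le_iInf fun htd => ?_)
  rw [ENNReal.inv_mul_le_iff hK ENNReal.ofReal_ne_top, ← ENNReal.tsum_mul_left]
  have hcover : S ⊆ ⋃ i, t i ∩ S := by
    rw [← iUnion_inter]
    exact subset_inter hSt subset_rfl
  refine (measure_mono hcover).trans ((measure_iUnion_le _).trans
    (ENNReal.tsum_le_tsum fun i => ?_))
  rcases (t i).eq_empty_or_nonempty with hempty | hne
  · simp [hempty]
  rw [iSup_pos hne]
  refine (measure_le_mul_ediam_rpow hb hs hA.le (fun n hn => h n hn _ inter_subset_right)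
    ((Metric.ediam_mono inter_subset_left).trans (htd i) |>.trans_lt hscale)).trans ?_
  gcongr
  exact inter_subset_left

end MassDistribution

/-! ### Densities and packing measures -/

section Packing

variable {X : Type*} [MetricSpace X] {s ε : ℝ} {A : Set X}

lemma sum_le_packingPreAt {ι : Type*} {x : ι → X} {r : ι → ℝ} {F : Finset ι}
    (hx : ∀ i ∈ F, x i ∈ A) (hr : ∀ i ∈ F, r i ∈ Ioc 0 ε)
    (hdisj : (F : Set ι).PairwiseDisjoint fun i => Metric.closedBall (x i) (r i)) :
    ∑ i ∈ F, ENNReal.ofReal ((2 * r i) ^ s) ≤ packingPreAt s ε A := by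
  classical
  have hinj : InjOn (fun i => (x i, r i)) F := by
    intro i hi j hj hij
    simp only [Prod.mk.injEq] at hij
    refine hdisj.elim hi hj (not_disjoint_iff.2 ⟨x i, ?_, ?_⟩)
    · exact Metric.mem_closedBall_self (hr i hi).1.le
    · exact hij.1 ▸ Metric.mem_closedBall_self (hr j hj).1.le
  refine le_iSup₂_of_le (F.image fun i => (x i, r i)) ⟨?_, ?_⟩
    (Finset.sum_image (f := fun p : X × ℝ => ENNReal.ofReal ((2 * p.2) ^ s)) hinj).ge
  · exact Finset.forall_mem_image.2 fun i hi => ⟨hx i hi, hr i hi⟩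
  · rw [Finset.coe_image]
    exact hinj.pairwiseDisjoint_image.2 hdisj

variable [SecondCountableTopology X] [MeasurableSpace X] {μ : Measure X} {K : ℝ≥0}

/-- The balls with the factor `5` removed come from a Vitali covering and form a packing. -/
lemma measure_le_mul_packingPreAt
    (h : ∀ x ∈ A, ∃ r ∈ Ioc 0 ε,
      μ (Metric.closedBall x (5 * r)) ≤ K * ENNReal.ofReal ((2 * r) ^ s)) :
    μ A ≤ K * packingPreAt s ε A := by
  choose! r hr hμr using h
  obtain ⟨u, huA, hdisj, hcover⟩ := Vitali.exists_disjoint_subfamily_covering_enlargement_closedBall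
    A id r ε (fun x hx => (hr x hx).2) 5 (by norm_num)
  have hucount : u.Countable := hdisj.countable_of_nonempty_interior fun x hx =>
    ⟨x, Metric.ball_subset_interior_closedBall (Metric.mem_ball_self (hr x (huA hx)).1)⟩
  have hA : A ⊆ ⋃ x ∈ u, Metric.closedBall x (5 * r x) := fun x hx => by
    obtain ⟨y, hy, hxy⟩ := hcover x hx
    exact mem_biUnion hy (hxy (Metric.mem_closedBall_self (hr x hx).1.le))
  calc μ A ≤ μ (⋃ x ∈ u, Metric.closedBall x (5 * r x)) := measure_mono hA
    _ ≤ ∑' x : u, μ (Metric.closedBall x.1 (5 * r x)) := measure_biUnion_le μ hucount _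
    _ ≤ ∑' x : u, K * ENNReal.ofReal ((2 * r x) ^ s) :=
        ENNReal.tsum_le_tsum fun x => hμr x (huA x.2)
    _ = K * ∑' x : u, ENNReal.ofReal ((2 * r x) ^ s) := ENNReal.tsum_mul_left
    _ ≤ K * packingPreAt s ε A := by
        gcongr
        rw [ENNReal.tsum_eq_iSup_sum]
        exact iSup_le fun F => sum_le_packingPreAt (fun x _ => huA x.2)
          (fun x _ => hr x (huA x.2)) fun x _ y _ hxy =>
            hdisj x.2 y.2 (Subtype.coe_injective.ne hxy)

lemma measure_le_mul_packingPre (hK : K ≠ 0)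
    (h : ∀ x ∈ A, ∃ᶠ r in 𝓝[>] (0 : ℝ),
      μ (Metric.closedBall x (5 * r)) ≤ K * ENNReal.ofReal ((2 * r) ^ s)) :
    μ A ≤ K * packingPre s A := by
  rw [← ENNReal.inv_mul_le_iff (ENNReal.coe_ne_zero.2 hK) ENNReal.coe_ne_top]
  refine le_iInf₂ fun ε hε => ?_
  rw [ENNReal.inv_mul_le_iff (ENNReal.coe_ne_zero.2 hK) ENNReal.coe_ne_top]
  refine measure_le_mul_packingPreAt fun x hx => ?_
  obtain ⟨r, hrμ, hr⟩ := ((h x hx).and_eventually (Ioc_mem_nhdsGT hε)).exists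
  exact ⟨r, hr, hrμ⟩

lemma measure_le_mul_packingOuter (hK : K ≠ 0)
    (h : ∀ x ∈ A, ∃ᶠ r in 𝓝[>] (0 : ℝ),
      μ (Metric.closedBall x (5 * r)) ≤ K * ENNReal.ofReal ((2 * r) ^ s)) :
    μ A ≤ K * packingOuter s A := by
  rw [← ENNReal.inv_mul_le_iff (ENNReal.coe_ne_zero.2 hK) ENNReal.coe_ne_top, packingOuter,
    OuterMeasure.ofFunction_apply]
  refine le_iInf₂ fun t hAt => ?_
  rw [ENNReal.inv_mul_le_iff (ENNReal.coe_ne_zero.2 hK) ENNReal.coe_ne_top,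
    ← ENNReal.tsum_mul_left]
  have hcover : A ⊆ ⋃ i, t i ∩ A := by
    rw [← iUnion_inter]
    exact subset_inter hAt subset_rfl
  refine (measure_mono hcover).trans ((measure_iUnion_le _).trans
    (ENNReal.tsum_le_tsum fun i => ?_))
  refine (measure_le_mul_packingPre hK fun x hx => h x hx.2).trans ?_
  gcongr
  exact packingPre_mono s inter_subset_left

omit [SecondCountableTopology X] in
lemma frequently_measure_closedBall_five_mul_le {x : X}
    (h : ∃ᶠ r in 𝓝[>] (0 : ℝ), μ (Metric.closedBall x r) ≤ K * ENNReal.ofReal (r ^ s)) :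
    ∃ᶠ r in 𝓝[>] (0 : ℝ), μ (Metric.closedBall x (5 * r)) ≤
      (K * Real.toNNReal ((5 / 2) ^ s) : ℝ≥0) * ENNReal.ofReal ((2 * r) ^ s) := by
  have hscale : Tendsto (fun r : ℝ => r / 5) (𝓝[>] 0) (𝓝[>] 0) := by
    refine tendsto_nhdsWithin_iff.2 ⟨?_, eventually_mem_nhdsWithin.mono fun r hr =>
      div_pos hr (by norm_num : (0 : ℝ) < 5)⟩
    exact ((continuous_id.div_const (5 : ℝ)).tendsto' 0 0 (zero_div _)).mono_left
      nhdsWithin_le_nhds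
  refine hscale.frequently ((h.and_eventually eventually_mem_nhdsWithin).mono ?_)
  rintro r ⟨hr, hr0 : 0 < r⟩
  have hpow : (5 / 2 : ℝ) ^ s * (2 * (r / 5)) ^ s = r ^ s := by
    rw [← Real.mul_rpow (by norm_num) (by positivity)]
    ring_nf
  rwa [mul_div_cancel₀ r (by norm_num : (5 : ℝ) ≠ 0), ENNReal.coe_mul, mul_assoc,
    ← ENNReal.ofReal, ← ENNReal.ofReal_mul (by positivity), hpow]

theorem absolutelyContinuous_packingMeasure [BorelSpace X]
    (h : ∀ᵐ x ∂μ, ∃ K : ℕ, ∃ᶠ r in 𝓝[>] (0 : ℝ),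
      μ (Metric.closedBall x r) ≤ K * ENNReal.ofReal (r ^ s)) :
    μ ≪ packingMeasure s := by
  refine AbsolutelyContinuous.mk fun A hA hA0 => ?_
  rw [packingMeasure, toMeasure_apply _ _ hA] at hA0
  set F : ℕ → Set X := fun K => {x | ∃ᶠ r in 𝓝[>] (0 : ℝ),
    μ (Metric.closedBall x r) ≤ K * ENNReal.ofReal (r ^ s)}
  have hF : μ (⋃ K, F K)ᶜ = 0 := by
    simpa only [F, ← ae_iff, ← mem_ae_iff, Filter.Eventually, ofPred_exists] using h
  have hcover : A ⊆ (⋃ K, F K)ᶜ ∪ ⋃ K, A ∩ F K := by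
    rw [← inter_iUnion, union_inter_distrib_left, compl_union_self, inter_univ]
    exact subset_union_right
  refine measure_mono_null hcover (measure_union_null hF (measure_iUnion_null fun K => ?_))
  have hK : (K + 1 : ℝ≥0) * Real.toNNReal ((5 / 2) ^ s) ≠ 0 := by
    have : 0 < Real.toNNReal ((5 / 2) ^ s) := Real.toNNReal_pos.2 (by positivity)
    positivity
  refine le_antisymm ((measure_le_mul_packingOuter hK (s := s) fun x hx =>
    frequently_measure_closedBall_five_mul_le (hx.2.mono fun r hr => hr.trans ?_)).trans ?_) bot_le
  · rw [measure_mono_null inter_subset_left hA0, mul_zero]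
  · gcongr
    push_cast
    exact le_self_add

end Packing

/-! ### Geometry of the coded cubes -/

section Cube

variable {D ℓ n : ℕ}

lemma mem_cube_iff (hℓ : 0 < ℓ) {k : Fin D → Fin (ℓ ^ n)} {x : E D} :
    x ∈ cube ℓ n k ↔ ∀ i, ⌊x i * (ℓ : ℝ) ^ n⌋ = ((k i : ℕ) : ℤ) := by
  have h0 : (0 : ℝ) < (ℓ : ℝ) ^ n := by positivity
  simp only [cube, mem_ofPred_eq, Int.floor_eq_iff, div_le_iff₀ h0, lt_div_iff₀ h0,
    Int.cast_natCast]

lemma cube_nonempty (hℓ : 0 < ℓ) (k : Fin D → Fin (ℓ ^ n)) : (cube ℓ n k).Nonempty := by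
  have h0 : (ℓ : ℝ) ^ n ≠ 0 := by positivity
  refine ⟨WithLp.toLp 2 fun i => ((k i : ℕ) : ℝ) / (ℓ : ℝ) ^ n, (mem_cube_iff hℓ).2 fun i => ?_⟩
  simp [div_mul_cancel₀ _ h0]

lemma cube_injective (hℓ : 0 < ℓ) : Function.Injective (cube (D := D) ℓ n) := by
  intro k k' hkk'
  obtain ⟨x, hx⟩ := cube_nonempty hℓ k
  have hx' : x ∈ cube ℓ n k' := hkk' ▸ hx
  funext i
  have := ((mem_cube_iff hℓ).1 hx i).symm.trans ((mem_cube_iff hℓ).1 hx' i)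
  exact Fin.ext (by exact_mod_cast this)

lemma dist_le_of_forall_abs_sub_le {x y : E D} {ε : ℝ} (hε : 0 ≤ ε)
    (h : ∀ i, |x i - y i| ≤ ε) : dist x y ≤ (D + 1) * ε := by
  rw [EuclideanSpace.dist_eq]
  refine Real.sqrt_le_iff.2 ⟨by positivity, ?_⟩
  calc ∑ i, dist (x i) (y i) ^ 2 ≤ ∑ _i : Fin D, ε ^ 2 :=
        Finset.sum_le_sum fun i _ => pow_le_pow_left₀ dist_nonneg (h i) 2
    _ = D * ε ^ 2 := by simp
    _ ≤ ((D + 1) * ε) ^ 2 := by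
        rw [mul_pow]
        refine mul_le_mul_of_nonneg_right ?_ (sq_nonneg ε)
        nlinarith [(Nat.cast_nonneg D : (0 : ℝ) ≤ D)]

lemma abs_sub_apply_le_dist (x y : E D) (i : Fin D) : |x i - y i| ≤ dist x y := by
  rw [dist_eq_norm]
  simpa using PiLp.norm_apply_le (x - y) i

lemma tendsto_const_mul_inv_pow {b : ℝ} (hb : 1 < b) (c : ℝ) :
    Tendsto (fun n : ℕ => c * (b ^ n)⁻¹) atTop (𝓝 0) := by
  simpa using (tendsto_inv_atTop_zero.comp (tendsto_pow_atTop_atTop_of_one_lt hb)).const_mul c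

end Cube

namespace IsCoding

variable {D ℓ : ℕ} {I : List (Fin (ℓ ^ D)) → Set (E D)} (hI : IsCoding I)
include hI

lemma exists_eq_cube (w : List (Fin (ℓ ^ D))) : ∃ k, I w = cube ℓ w.length k := by
  obtain ⟨k, hk⟩ := (hI.bijOn w.length).mapsTo (rfl : w.length = w.length)
  exact ⟨k, hk.symm⟩

/-- The lower corner of the cube `I w`, in units of its side length `ℓ ^ (-w.length)`; integers
allow the subtraction of two corners. -/
def corner (w : List (Fin (ℓ ^ D))) (i : Fin D) : ℤ :=
  ((hI.exists_eq_cube w).choose i : ℕ)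

lemma eq_setOf (w : List (Fin (ℓ ^ D))) :
    I w = {x | ∀ i, (hI.corner w i : ℝ) / (ℓ : ℝ) ^ w.length ≤ x i ∧
      x i < ((hI.corner w i : ℝ) + 1) / (ℓ : ℝ) ^ w.length} := by
  conv_lhs => rw [(hI.exists_eq_cube w).choose_spec]
  simp only [cube, corner, Int.cast_natCast]

lemma mem_iff (hℓ : 0 < ℓ) {w : List (Fin (ℓ ^ D))} {x : E D} :
    x ∈ I w ↔ ∀ i, ⌊x i * (ℓ : ℝ) ^ w.length⌋ = hI.corner w i := by
  conv_lhs => rw [(hI.exists_eq_cube w).choose_spec]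
  exact mem_cube_iff hℓ

lemma nonempty (hℓ : 0 < ℓ) (w : List (Fin (ℓ ^ D))) : (I w).Nonempty := by
  rw [(hI.exists_eq_cube w).choose_spec]
  exact cube_nonempty hℓ _

lemma measurableSet (w : List (Fin (ℓ ^ D))) : MeasurableSet (I w) := by
  rw [hI.eq_setOf w]
  have hcoord : ∀ i : Fin D, Measurable fun x : E D => x i := fun i =>
    (EuclideanSpace.proj (𝕜 := ℝ) i).continuous.measurable
  simp only [ofPred_forall, ofPred_and]
  exact MeasurableSet.iInter fun i => (measurableSet_le measurable_const (hcoord i)).inter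
    (measurableSet_lt (hcoord i) measurable_const)

lemma eq_of_corner_eq {w w' : List (Fin (ℓ ^ D))} (hlen : w.length = w'.length)
    (h : hI.corner w = hI.corner w') : w = w' := by
  refine (hI.bijOn w'.length).injOn hlen rfl ?_
  rw [hI.eq_setOf w, hI.eq_setOf w', h, hlen]

lemma eq_of_mem (hℓ : 0 < ℓ) {w w' : List (Fin (ℓ ^ D))} (hlen : w.length = w'.length) {x : E D}
    (hx : x ∈ I w) (hx' : x ∈ I w') : w = w' := by
  refine hI.eq_of_corner_eq hlen (funext fun i => ?_)
  rw [← (hI.mem_iff hℓ).1 hx i, ← (hI.mem_iff hℓ).1 hx' i, hlen]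

lemma pairwiseDisjoint (hℓ : 0 < ℓ) {n : ℕ} {T : Set (List (Fin (ℓ ^ D)))}
    (hT : ∀ w ∈ T, w.length = n) : T.PairwiseDisjoint I := fun w hw w' hw' hne =>
  disjoint_left.2 fun _ hx hx' =>
    hne (hI.eq_of_mem hℓ ((hT w hw).trans (hT w' hw').symm) hx hx')

lemma subset_unitCube (hℓ : 0 < ℓ) (w : List (Fin (ℓ ^ D))) : I w ⊆ unitCube D := by
  rw [(hI.exists_eq_cube w).choose_spec]
  intro x hx i
  have h0 : (0 : ℝ) < (ℓ : ℝ) ^ w.length := by positivity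
  refine ⟨le_trans (by positivity) (hx i).1, (hx i).2.trans_le ((div_le_one h0).2 ?_)⟩
  exact_mod_cast ((hI.exists_eq_cube w).choose i).2

lemma exists_mem (hℓ : 0 < ℓ) {x : E D} (hx : x ∈ unitCube D) (n : ℕ) :
    ∃ w ∈ words (Fin (ℓ ^ D)) n, x ∈ I w := by
  have h0 : (0 : ℝ) < (ℓ : ℝ) ^ n := by positivity
  have hlt : ∀ i, ⌊x i * (ℓ : ℝ) ^ n⌋₊ < ℓ ^ n := fun i => by
    rw [Nat.floor_lt (mul_nonneg (hx i).1 h0.le)]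
    push_cast
    exact mul_lt_of_lt_one_left h0 (hx i).2
  obtain ⟨w, hw, hIw⟩ := (hI.bijOn n).surjOn (mem_range_self fun i => ⟨_, hlt i⟩)
  refine ⟨w, mem_words.2 hw, ?_⟩
  rw [hIw, mem_cube_iff hℓ]
  exact fun i => (Int.natCast_floor_eq_floor (mul_nonneg (hx i).1 h0.le)).symm

lemma nil_eq (hℓ : 0 < ℓ) : I [] = unitCube D := by
  refine (hI.subset_unitCube hℓ []).antisymm fun x hx => ?_
  obtain ⟨w, hw, hxw⟩ := hI.exists_mem hℓ hx 0
  rwa [List.length_eq_zero_iff.1 (mem_words.1 hw)] at hxw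

lemma append_subset (u v : List (Fin (ℓ ^ D))) : I (u ++ v) ⊆ I u := by
  induction v using List.reverseRecOn with
  | nil => rw [List.append_nil]
  | append_singleton v a ih =>
    rw [← List.append_assoc]
    exact (hI.nested _ a).trans ih

lemma exists_append_mem (hℓ : 0 < ℓ) {u : List (Fin (ℓ ^ D))} {x : E D} (hx : x ∈ I u) (n : ℕ) :
    ∃ v ∈ words (Fin (ℓ ^ D)) n, x ∈ I (u ++ v) := by
  obtain ⟨w, hw, hxw⟩ := hI.exists_mem hℓ (hI.subset_unitCube hℓ u hx) (u.length + n)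
  rw [mem_words] at hw
  have hsplit : I (w.take u.length ++ w.drop u.length) = I w := by rw [List.take_append_drop]
  have hu : w.take u.length = u :=
    hI.eq_of_mem hℓ (by simp [hw]) (hI.append_subset _ _ (hsplit ▸ hxw)) hx
  rw [hu] at hsplit
  exact ⟨w.drop u.length, by simp [hw], hsplit ▸ hxw⟩

lemma eq_biUnion_append (hℓ : 0 < ℓ) (u : List (Fin (ℓ ^ D))) (n : ℕ) :
    I u = ⋃ v ∈ words (Fin (ℓ ^ D)) n, I (u ++ v) := by
  refine Subset.antisymm (fun x hx => ?_) (iUnion₂_subset fun v _ => hI.append_subset u v)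
  obtain ⟨v, hv, hxv⟩ := hI.exists_append_mem hℓ hx n
  exact mem_biUnion hv hxv

lemma subset_of_mem (hℓ : 0 < ℓ) {u w : List (Fin (ℓ ^ D))} (hlen : u.length ≤ w.length) {x : E D}
    (hu : x ∈ I u) (hw : x ∈ I w) : I w ⊆ I u := by
  obtain ⟨v, hv, hx⟩ := hI.exists_append_mem hℓ hu (w.length - u.length)
  have hwuv : w = u ++ v := hI.eq_of_mem hℓ (by simp [mem_words.1 hv]; omega) hw hx
  exact hwuv ▸ hI.append_subset u v

lemma closure_subset (w : List (Fin (ℓ ^ D))) :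
    closure (I w) ⊆ {x | ∀ i, (hI.corner w i : ℝ) / (ℓ : ℝ) ^ w.length ≤ x i ∧
      x i ≤ ((hI.corner w i : ℝ) + 1) / (ℓ : ℝ) ^ w.length} := by
  refine closure_minimal ?_ ?_
  · conv_lhs => rw [hI.eq_setOf w]
    exact fun x hx i => ⟨(hx i).1, (hx i).2.le⟩
  · have hcoord : ∀ i : Fin D, Continuous fun x : E D => x i := fun i =>
      (EuclideanSpace.proj (𝕜 := ℝ) i).continuous
    simp only [ofPred_forall, ofPred_and]
    exact isClosed_iInter fun i => (isClosed_le continuous_const (hcoord i)).inter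
      (isClosed_le (hcoord i) continuous_const)

lemma dist_le_of_mem_closure {w : List (Fin (ℓ ^ D))} {x y : E D} (hx : x ∈ closure (I w))
    (hy : y ∈ closure (I w)) : dist x y ≤ (D + 1) * ((ℓ : ℝ) ^ w.length)⁻¹ := by
  refine dist_le_of_forall_abs_sub_le (by positivity) fun i => ?_
  obtain ⟨hx₁, hx₂⟩ := hI.closure_subset w hx i
  obtain ⟨hy₁, hy₂⟩ := hI.closure_subset w hy i
  rw [add_div, one_div] at hx₂ hy₂
  exact abs_le.2 ⟨by linarith, by linarith⟩

lemma ediam_closure_le (w : List (Fin (ℓ ^ D))) :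
    Metric.ediam (closure (I w)) ≤ ENNReal.ofReal ((D + 1) * ((ℓ : ℝ) ^ w.length)⁻¹) :=
  Metric.ediam_le fun x hx y hy => by
    rw [edist_dist]
    exact ENNReal.ofReal_le_ofReal (hI.dist_le_of_mem_closure hx hy)

lemma ediam_closure_rpow_le {s : ℝ} (hs : 0 ≤ s) (w : List (Fin (ℓ ^ D))) :
    Metric.ediam (closure (I w)) ^ s ≤
      ENNReal.ofReal (((D : ℝ) + 1) ^ s * (ℓ : ℝ) ^ (-(w.length * s))) := by
  refine (ENNReal.rpow_le_rpow (hI.ediam_closure_le w) hs).trans_eq ?_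
  rw [ENNReal.ofReal_rpow_of_nonneg (by positivity) hs,
    Real.mul_rpow (by positivity) (by positivity), inv_pow_rpow_eq (by positivity)]

lemma abs_corner_sub_le (hℓ : 0 < ℓ) {w w' : List (Fin (ℓ ^ D))} (hlen : w'.length = w.length)
    {x y : E D} (hx : x ∈ closure (I w)) (hy : y ∈ closure (I w'))
    (hxy : dist x y ≤ ((ℓ : ℝ) ^ w.length)⁻¹) (i : Fin D) :
    |hI.corner w' i - hI.corner w i| ≤ 2 := by
  have h0 : (0 : ℝ) < (ℓ : ℝ) ^ w.length := by positivity
  obtain ⟨hx₁, hx₂⟩ := hI.closure_subset w hx i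
  obtain ⟨hy₁, hy₂⟩ := hI.closure_subset w' hy i
  rw [hlen] at hy₁ hy₂
  rw [div_le_iff₀ h0] at hx₁ hy₁
  rw [le_div_iff₀ h0] at hx₂ hy₂
  have hscaled : |x i * (ℓ : ℝ) ^ w.length - y i * (ℓ : ℝ) ^ w.length| ≤ 1 := by
    rw [← sub_mul, abs_mul, abs_of_pos h0, ← le_div_iff₀ h0, one_div]
    exact (abs_sub_apply_le_dist x y i).trans hxy
  obtain ⟨hl, hu⟩ := abs_le.1 hscaled
  have : |(hI.corner w' i - hI.corner w i : ℝ)| ≤ 2 := abs_le.2 ⟨by linarith, by linarith⟩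
  exact_mod_cast this

lemma card_le_of_abs_corner_sub_le {n : ℕ} {T : Finset (List (Fin (ℓ ^ D)))}
    (hT : ∀ w ∈ T, w.length = n) (k : Fin D → ℤ) (h : ∀ w ∈ T, ∀ i, |hI.corner w i - k i| ≤ 2) :
    T.card ≤ 5 ^ D := by
  have hcard : (Fintype.piFinset fun i => Finset.Icc (k i - 2) (k i + 2)).card = 5 ^ D := by
    have : ∀ i, (Finset.Icc (k i - 2) (k i + 2)).card = 5 := fun i => by
      rw [Int.card_Icc]
      omega
    simp [Fintype.card_piFinset, this]
  rw [← hcard]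
  refine Finset.card_le_card_of_injOn hI.corner (fun w hw => ?_) fun w hw w' hw' heq =>
    hI.eq_of_corner_eq ((hT w hw).trans (hT w' hw').symm) heq
  rw [Finset.mem_coe, Fintype.mem_piFinset]
  intro i
  have := abs_le.1 (h w hw i)
  exact Finset.mem_Icc.2 ⟨by linarith [this.1], by linarith [this.2]⟩

lemma card_le_of_meets (hℓ : 0 < ℓ) {n : ℕ} {T : Finset (List (Fin (ℓ ^ D)))}
    (hT : ∀ w ∈ T, w.length = n) {U : Set (E D)}
    (hU : Metric.ediam U ≤ ENNReal.ofReal ((ℓ : ℝ) ^ n)⁻¹)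
    (h : ∀ w ∈ T, (closure (I w) ∩ U).Nonempty) : T.card ≤ 5 ^ D := by
  rcases T.eq_empty_or_nonempty with rfl | ⟨w₀, hw₀⟩
  · simp
  refine hI.card_le_of_abs_corner_sub_le hT (hI.corner w₀) fun w hw i => ?_
  obtain ⟨x, hx, hxU⟩ := h w₀ hw₀
  obtain ⟨y, hy, hyU⟩ := h w hw
  refine hI.abs_corner_sub_le hℓ ((hT w hw).trans (hT w₀ hw₀).symm) hx hy ?_ i
  rw [hT w₀ hw₀, ← edist_le_ofReal (by positivity)]
  exact (Metric.edist_le_ediam_of_mem hxU hyU).trans hU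

end IsCoding

/-! ### Measures on the coded cubes -/

/-- The union of the cubes of generation `n` whose word satisfies `P`. -/
def cubesWith {α X : Type*} (I : List α → Set X) (n : ℕ) (P : List α → Prop) : Set X :=
  ⋃ w ∈ {w | w.length = n ∧ P w}, I w

lemma mem_cubesWith {α X : Type*} {I : List α → Set X} {n : ℕ} {P : List α → Prop} {x : X} :
    x ∈ cubesWith I n P ↔ ∃ w, (w.length = n ∧ P w) ∧ x ∈ I w := by
  simp only [cubesWith, mem_iUnion₂, mem_ofPred_eq, exists_prop]

namespace IsCoding

variable {D ℓ : ℕ} {I : List (Fin (ℓ ^ D)) → Set (E D)} (hI : IsCoding I) {μ ν : Measure (E D)}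
include hI

lemma measurableSet_cubesWith (n : ℕ) (P : List (Fin (ℓ ^ D)) → Prop) :
    MeasurableSet (cubesWith I n P) :=
  MeasurableSet.biUnion (to_countable _) fun w _ => hI.measurableSet w

lemma measurableSet_limsup_cubesWith (P : ℕ → List (Fin (ℓ ^ D)) → Prop) :
    MeasurableSet (limsup (fun n => cubesWith I n (P n)) atTop) :=
  MeasurableSet.measurableSet_limsup fun n => hI.measurableSet_cubesWith n (P n)

lemma measure_biUnion (hℓ : 0 < ℓ) {n : ℕ} {T : Finset (List (Fin (ℓ ^ D)))}
    (hT : ∀ w ∈ T, w.length = n) : μ (⋃ w ∈ T, I w) = ∑ w ∈ T, μ (I w) :=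
  measure_biUnion_finset (hI.pairwiseDisjoint hℓ hT) fun w _ => hI.measurableSet w

lemma pairwiseDisjoint_append (hℓ : 0 < ℓ) (u : List (Fin (ℓ ^ D))) {n : ℕ}
    {T : Set (List (Fin (ℓ ^ D)))} (hT : ∀ v ∈ T, v.length = n) :
    T.PairwiseDisjoint fun v => I (u ++ v) := fun v hv v' hv' hne =>
  disjoint_left.2 fun _ hx hx' => hne <| List.append_cancel_left <|
    hI.eq_of_mem hℓ (by simp [hT v hv, hT v' hv']) hx hx'

lemma measureReal_cubesWith (hℓ : 0 < ℓ) [IsFiniteMeasure μ] (n : ℕ)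
    (P : List (Fin (ℓ ^ D)) → Prop) [DecidablePred P] :
    μ.real (cubesWith I n P) = ∑ w ∈ words (Fin (ℓ ^ D)) n with P w, μ.real (I w) := by
  rw [← measureReal_biUnion_finset (hI.pairwiseDisjoint hℓ (n := n) fun w hw => by simp_all)
    fun w _ => hI.measurableSet w]
  simp [cubesWith]

lemma sum_measureReal_append (hℓ : 0 < ℓ) [IsFiniteMeasure μ] (u : List (Fin (ℓ ^ D))) (n : ℕ) :
    ∑ v ∈ words (Fin (ℓ ^ D)) n, μ.real (I (u ++ v)) = μ.real (I u) := by
  rw [hI.eq_biUnion_append hℓ u n, measureReal_biUnion_finset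
    (hI.pairwiseDisjoint_append hℓ u fun v hv => mem_words.1 hv) fun v _ => hI.measurableSet _]

lemma partitionSum_eq_powSum (hℓ : 0 < ℓ) (n : ℕ) (q : ℝ) :
    partitionSum ℓ μ n q = powSum (fun w => μ.real (I w)) n q := by
  have hwords : {w : List (Fin (ℓ ^ D)) | w.length = n} = words (Fin (ℓ ^ D)) n := by
    ext
    simp
  rw [powSum, chargedWords, Finset.sum_filter, ← finsum_mem_coe_finset, ← hwords,
    finsum_mem_eq_of_bijOn (g := fun S => if μ.real S ≠ 0 then μ.real S ^ q else 0) I (hI.bijOn n)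
      fun _ _ => rfl,
    cubes, finsum_mem_range (cube_injective hℓ), finsum_eq_sum_of_fintype, partitionSum]
  simp only [ne_eq, ite_not]

lemma lqSpectrum_eq_wordSpectrum (hℓ : 0 < ℓ) :
    lqSpectrum ℓ μ = wordSpectrum (fun w => μ.real (I w)) ℓ := by
  funext q
  simp only [lqSpectrum, wordSpectrum, hI.partitionSum_eq_powSum hℓ]

lemma measure_compl_unitCube (hℓ : 0 < ℓ) [IsProbabilityMeasure μ] (h : μ (unitCube D) = 1) :
    μ (unitCube D)ᶜ = 0 := by
  rw [← hI.nil_eq hℓ] at h ⊢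
  exact (prob_compl_eq_zero_iff (hI.measurableSet [])).2 h

lemma measure_le_sum_of_meets (hℓ : 0 < ℓ) (hμ : μ (unitCube D)ᶜ = 0) {n : ℕ} {S : Set (E D)}
    {T : Finset (List (Fin (ℓ ^ D)))}
    (hT : ∀ w ∈ words (Fin (ℓ ^ D)) n, (I w ∩ S).Nonempty → w ∈ T) :
    μ S ≤ ∑ w ∈ T, μ (I w) := by
  have hS : S ⊆ (unitCube D)ᶜ ∪ ⋃ w ∈ T, I w := fun x hx => or_iff_not_imp_left.2 fun hxc => by
    obtain ⟨w, hw, hxw⟩ := hI.exists_mem hℓ (not_not.1 hxc) n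
    exact mem_biUnion (hT w hw ⟨x, hxw, hx⟩) hxw
  calc μ S ≤ μ (unitCube D)ᶜ + μ (⋃ w ∈ T, I w) := (measure_mono hS).trans (measure_union_le _ _)
    _ = μ (⋃ w ∈ T, I w) := by rw [hμ, zero_add]
    _ ≤ ∑ w ∈ T, μ (I w) := measure_biUnion_finset_le _ _

lemma measure_le_of_forall_le (hℓ : 0 < ℓ) (hμ : μ (unitCube D)ᶜ = 0) {n : ℕ} {U : Set (E D)}
    (hU : Metric.ediam U ≤ ENNReal.ofReal ((ℓ : ℝ) ^ n)⁻¹) {B : ℝ≥0∞}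
    (h : ∀ w ∈ words (Fin (ℓ ^ D)) n, (I w ∩ U).Nonempty → μ (I w) ≤ B) : μ U ≤ 5 ^ D * B := by
  classical
  set T := {w ∈ words (Fin (ℓ ^ D)) n | (I w ∩ U).Nonempty}
  have hcard : T.card ≤ 5 ^ D :=
    hI.card_le_of_meets hℓ (fun w hw => mem_words.1 (Finset.mem_filter.1 hw).1) hU fun w hw =>
      (Finset.mem_filter.1 hw).2.mono (inter_subset_inter_left _ subset_closure)
  calc μ U ≤ ∑ w ∈ T, μ (I w) :=
        hI.measure_le_sum_of_meets hℓ hμ fun w hw hne => Finset.mem_filter.2 ⟨hw, hne⟩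
    _ ≤ T.card • B := Finset.sum_le_card_nsmul _ _ _ fun w hw =>
        h w (Finset.mem_filter.1 hw).1 (Finset.mem_filter.1 hw).2
    _ ≤ 5 ^ D * B := by
        rw [nsmul_eq_mul]
        gcongr
        exact_mod_cast hcard

lemma isOpen_inter_unitCube_subset_iUnion (hℓ : 1 < ℓ) {U : Set (E D)} (hU : IsOpen U) :
    U ∩ unitCube D ⊆ ⋃ n, cubesWith I n fun w => I w ⊆ U := by
  rintro x ⟨hxU, hx⟩
  obtain ⟨ε, hε, hball⟩ := Metric.isOpen_iff.1 hU x hxU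
  obtain ⟨n, hn⟩ := ((tendsto_const_mul_inv_pow (b := ℓ) (by exact_mod_cast hℓ)
    ((D : ℝ) + 1)).eventually_lt_const hε).exists
  obtain ⟨w, hw, hxw⟩ := hI.exists_mem (zero_lt_one.trans hℓ) hx n
  rw [mem_words] at hw
  refine mem_iUnion.2 ⟨n, mem_cubesWith.2 ⟨w, ⟨hw, fun y hy => hball ?_⟩, hxw⟩⟩
  exact (hI.dist_le_of_mem_closure (subset_closure hy) (subset_closure hxw)).trans_lt (hw ▸ hn)

lemma monotone_cubesWith_subset (hℓ : 0 < ℓ) (U : Set (E D)) :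
    Monotone fun n => cubesWith I n fun w => I w ⊆ U := by
  refine monotone_nat_of_le_succ fun n x hx => ?_
  obtain ⟨w, ⟨hw, hwU⟩, hxw⟩ := mem_cubesWith.1 hx
  obtain ⟨v, hv, hxv⟩ := hI.exists_append_mem hℓ hxw 1
  exact mem_cubesWith.2 ⟨w ++ v, ⟨by simp [hw, mem_words.1 hv],
    (hI.append_subset w v).trans hwU⟩, hxv⟩

lemma measure_le_of_forall_measure_le (hℓ : 1 < ℓ) [ν.OuterRegular] (hμ : μ (unitCube D)ᶜ = 0)
    (h : ∀ w, μ (I w) ≤ ν (I w)) : μ ≤ ν := by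
  classical
  have hℓ0 := zero_lt_one.trans hℓ
  refine le_of_forall_isOpen fun U hU => ?_
  have hle : ∀ n, μ (cubesWith I n fun w => I w ⊆ U) ≤ ν U := fun n => by
    have hlen : ∀ w ∈ {w ∈ words (Fin (ℓ ^ D)) n | I w ⊆ U}, w.length = n := fun w hw =>
      mem_words.1 (Finset.mem_filter.1 hw).1
    have heq : cubesWith I n (fun w => I w ⊆ U) =
        ⋃ w ∈ {w ∈ words (Fin (ℓ ^ D)) n | I w ⊆ U}, I w := by
      simp [cubesWith]
    rw [heq, hI.measure_biUnion hℓ0 hlen]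
    refine (Finset.sum_le_sum fun w _ => h w).trans ?_
    rw [← hI.measure_biUnion hℓ0 hlen]
    exact measure_mono (iUnion₂_subset fun w hw => (Finset.mem_filter.1 hw).2)
  calc μ U ≤ μ ((⋃ n, cubesWith I n fun w => I w ⊆ U) ∪ (unitCube D)ᶜ) :=
        measure_mono fun x hx => or_iff_not_imp_right.2 fun hxc =>
          hI.isOpen_inter_unitCube_subset_iUnion hℓ hU ⟨hx, not_not.1 hxc⟩
    _ ≤ μ (⋃ n, cubesWith I n fun w => I w ⊆ U) :=
        (measure_union_le _ _).trans_eq (by rw [hμ, add_zero])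
    _ = ⨆ n, μ (cubesWith I n fun w => I w ⊆ U) :=
        (hI.monotone_cubesWith_subset hℓ0 U).measure_iUnion
    _ ≤ ν U := iSup_le hle

lemma measure_compl_eq_zero (hℓ : 1 < ℓ) [IsFiniteMeasure μ] (hμ : μ (unitCube D)ᶜ = 0)
    {A : Set (E D)} (hA : MeasurableSet A) {c : ℝ≥0∞} (hc : c ≠ 0)
    (h : ∀ u, c * μ (I u) ≤ μ (I u ∩ A)) : μ Aᶜ = 0 := by
  have hle : c • μ ≤ μ.restrict A := by
    refine hI.measure_le_of_forall_measure_le hℓ (by simp [hμ]) fun u => ?_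
    rw [Measure.smul_apply, restrict_apply (hI.measurableSet u), smul_eq_mul]
    exact h u
  have hcompl := hle Aᶜ
  rw [restrict_apply hA.compl, compl_inter_self, measure_empty, Measure.smul_apply,
    smul_eq_mul] at hcompl
  exact (mul_eq_zero.1 (le_antisymm hcompl bot_le)).resolve_left hc

/-! ### Points that lie infinitely often in prescribed cubes -/

lemma measure_limsup_cubesWith_eq_zero (hℓ : 0 < ℓ) [IsFiniteMeasure μ]
    {P : ℕ → List (Fin (ℓ ^ D)) → Prop} [∀ n, DecidablePred (P n)] {A ρ : ℝ} (hρ₀ : 0 ≤ ρ)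
    (hρ₁ : ρ < 1) (h : ∀ n, ∑ w ∈ words (Fin (ℓ ^ D)) n with P n w, μ.real (I w) ≤ A * ρ ^ n) :
    μ (limsup (fun n => cubesWith I n (P n)) atTop) = 0 := by
  have hsum : Summable fun n => μ.real (cubesWith I n (P n)) :=
    ((summable_geometric_of_lt_one hρ₀ hρ₁).mul_left A).of_nonneg_of_le
      (fun _ => measureReal_nonneg) fun n => (hI.measureReal_cubesWith hℓ n _).trans_le (h n)
  refine measure_limsup_atTop_eq_zero ?_
  simpa using hsum.tsum_ofReal_ne_top

lemma le_measure_inter_limsup_cubesWith (hℓ : 0 < ℓ) [IsFiniteMeasure μ]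
    {P : ℕ → List (Fin (ℓ ^ D)) → Prop} [∀ n, DecidablePred (P n)] {u : List (Fin (ℓ ^ D))} {c : ℝ}
    (h : ∃ᶠ n in atTop, c ≤ ∑ v ∈ words (Fin (ℓ ^ D)) n with P (u.length + n) (u ++ v),
      μ.real (I (u ++ v))) :
    ENNReal.ofReal c ≤ μ (I u ∩ limsup (fun n => cubesWith I n (P n)) atTop) := by
  rw [inter_comm, ← restrict_apply' (hI.measurableSet u)]
  have hshift : Tendsto (u.length + ·) atTop atTop :=
    tendsto_atTop_mono (fun n => Nat.le_add_left n _) tendsto_id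
  refine le_measure_limsup (fun n => hI.measurableSet_cubesWith n _)
    (hshift.frequently (h.mono fun n hn => ?_))
  have hT : ∀ v ∈ {v ∈ words (Fin (ℓ ^ D)) n | P (u.length + n) (u ++ v)}, v.length = n ∧
      P (u.length + n) (u ++ v) := fun v hv => by simpa using hv
  rw [restrict_apply' (hI.measurableSet u)]
  refine (ENNReal.ofReal_le_ofReal hn).trans ?_
  rw [← measureReal_biUnion_finset (hI.pairwiseDisjoint_append hℓ u fun v hv => (hT v hv).1)
    fun v _ => hI.measurableSet _, ofReal_measureReal (measure_ne_top _ _)]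
  refine measure_mono (iUnion₂_subset fun v hv x hx => ⟨?_, hI.append_subset u v hx⟩)
  exact mem_cubesWith.2 ⟨u ++ v, ⟨by simp [(hT v hv).1], (hT v hv).2⟩, hx⟩

lemma exists_pairwiseDisjoint_cover (hℓ : 0 < ℓ) (P : List (Fin (ℓ ^ D)) → Prop) (n : ℕ) :
    ∃ W : Set (List (Fin (ℓ ^ D))), (∀ w ∈ W, n ≤ w.length ∧ P w) ∧ W.PairwiseDisjoint I ∧
      ∀ w, n ≤ w.length → P w → I w ⊆ ⋃ w' ∈ W, I w' := by
  set W : Set (List (Fin (ℓ ^ D))) := {w | (n ≤ w.length ∧ P w) ∧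
    ∀ w', n ≤ w'.length → P w' → w'.length < w.length → ¬ I w ⊆ I w'}
  refine ⟨W, fun w hw => hw.1, fun w hw w' hw' hne => disjoint_left.2 fun x hx hx' => ?_,
    fun w => ?_⟩
  · rcases lt_trichotomy w.length w'.length with hlt | heq | hlt
    · exact hw'.2 w hw.1.1 hw.1.2 hlt (hI.subset_of_mem hℓ hlt.le hx hx')
    · exact hne (hI.eq_of_mem hℓ heq hx hx')
    · exact hw.2 w' hw'.1.1 hw'.1.2 hlt (hI.subset_of_mem hℓ hlt.le hx' hx)
  · induction hk : w.length using Nat.strong_induction_on generalizing w with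
    | _ k ih =>
      intro hn hP
      by_cases hw : w ∈ W
      · exact subset_biUnion_of_mem hw
      · simp only [W, mem_ofPred_eq, not_and, not_forall, not_not] at hw
        obtain ⟨w', hn', hP', hlt, hsub⟩ := hw ⟨hk ▸ hn, hP⟩
        exact hsub.trans (ih w'.length (hk ▸ hlt) w' rfl hn' hP')

lemma ediam_rpow_le_of_le_measureReal [IsFiniteMeasure μ] {s a : ℝ} (hs : 0 ≤ s) (ha : 0 < a)
    {w : List (Fin (ℓ ^ D))} (h : a * (ℓ : ℝ) ^ (-(w.length * s)) ≤ μ.real (I w)) :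
    Metric.ediam (I w) ^ s ≤ ENNReal.ofReal (((D : ℝ) + 1) ^ s / a) * μ (I w) := by
  refine (ENNReal.rpow_le_rpow (Metric.ediam_mono subset_closure) hs).trans
    ((hI.ediam_closure_rpow_le hs w).trans ?_)
  rw [← ofReal_measureReal (measure_ne_top μ (I w)), ← ENNReal.ofReal_mul (by positivity),
    div_mul_eq_mul_div, mul_div_assoc]
  gcongr
  rwa [le_div_iff₀' ha]

lemma hausdorffMeasure_limsup_cubesWith_le (hℓ : 1 < ℓ) [IsFiniteMeasure μ] {s a : ℝ}
    (hs : 0 ≤ s) (ha : 0 < a) :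
    μH[s] (limsup (fun n => cubesWith I n fun w => a * (ℓ : ℝ) ^ (-(n * s)) ≤ μ.real (I w)) atTop) ≤
      ENNReal.ofReal (((D : ℝ) + 1) ^ s / a) * μ univ := by
  choose W hW hdisj hcover using fun n => hI.exists_pairwiseDisjoint_cover (zero_lt_one.trans hℓ)
    (fun w => a * (ℓ : ℝ) ^ (-(w.length * s)) ≤ μ.real (I w)) n
  have hlim : Tendsto (fun n : ℕ => ENNReal.ofReal (((D : ℝ) + 1) * ((ℓ : ℝ) ^ n)⁻¹)) atTop
      (𝓝 0) := by
    simpa using ENNReal.tendsto_ofReal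
      (tendsto_const_mul_inv_pow (b := ℓ) (by exact_mod_cast hℓ) ((D : ℝ) + 1))
  have hsum : ∀ n, ∑' w : W n, Metric.ediam (I w) ^ s ≤
      ENNReal.ofReal (((D : ℝ) + 1) ^ s / a) * μ univ := fun n => by
    refine (ENNReal.tsum_le_tsum fun w : W n =>
      hI.ediam_rpow_le_of_le_measureReal hs ha (hW n w w.2).2).trans ?_
    rw [ENNReal.tsum_mul_left, ← MeasureTheory.measure_biUnion (to_countable _) (hdisj n)
      fun w _ => hI.measurableSet w]
    gcongr
    exact subset_univ _
  refine (hausdorffMeasure_le_liminf_tsum s _ _ hlim (fun n (w : W n) => I w)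
    (Eventually.of_forall fun n w => ?_) (Eventually.of_forall fun n x hx => ?_)).trans
    ((liminf_le_liminf (Eventually.of_forall hsum)).trans (by simp))
  · refine (Metric.ediam_mono subset_closure).trans ((hI.ediam_closure_le w).trans ?_)
    have : (1 : ℝ) ≤ ℓ := by exact_mod_cast hℓ.le
    gcongr
    exact (hW n w w.2).1
  · obtain ⟨k, hk, hxk⟩ := frequently_atTop.1 (mem_limsup_iff_frequently_mem.1 hx) n
    obtain ⟨w, ⟨rfl, hw⟩, hxw⟩ := mem_cubesWith.1 hxk
    simpa only [biUnion_eq_iUnion] using hcover n w hk hw hxw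

end IsCoding

lemma IsQuasiBernoulli.exists_isQuasiMultiplicative {D ℓ : ℕ} {I : List (Fin (ℓ ^ D)) → Set (E D)}
    {μ : Measure (E D)} (hμ : IsQuasiBernoulli I μ) (hI : IsCoding I) (hℓ : 0 < ℓ) :
    ∃ C, IsQuasiMultiplicative (fun w => μ.real (I w)) C := by
  have := hμ.isProbabilityMeasure
  obtain ⟨C, hC, h⟩ := hμ.quasi
  refine ⟨C, hC, fun _ => measureReal_nonneg, ?_, hI.sum_measureReal_append hℓ,
    fun u v => (h u v).1, fun u v => (h u v).2⟩
  rw [hI.nil_eq hℓ, measureReal_def, hμ.measure_unitCube, ENNReal.toReal_one]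

namespace IsQuasiMultiplicative

variable {α : Type*} [Finite α] {p : List α → ℝ} {C b d : ℝ} (hp : IsQuasiMultiplicative p C)
include hp

lemma div_mul_le_sum_append {T : Finset (List α)} {c : ℝ} (h : c ≤ ∑ v ∈ T, p v) (u : List α) :
    c / C * p u ≤ ∑ v ∈ T, p (u ++ v) :=
  have := hp.pos
  have := hp.nonneg u
  calc c / C * p u = 1 / C * (p u * c) := by ring
    _ ≤ 1 / C * (p u * ∑ v ∈ T, p v) := by gcongr
    _ = ∑ v ∈ T, 1 / C * (p u * p v) := by rw [Finset.mul_sum, Finset.mul_sum]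
    _ ≤ ∑ v ∈ T, p (u ++ v) := Finset.sum_le_sum fun v _ => hp.lower u v

lemma mul_rpow_le_append (hb : 0 < b) {K : ℝ} {u v : List α} {n : ℕ} (hu : p u ≠ 0)
    (hv : K * C * b ^ (-(u.length * d)) / p u * b ^ (-(n * d)) ≤ p v) :
    K * b ^ (-((u.length + n : ℕ) * d)) ≤ p (u ++ v) := by
  have hC := hp.pos
  have hpu := hp.pos_of_ne_zero hu
  calc K * b ^ (-((u.length + n : ℕ) * d))
      = 1 / C * (p u * (K * C * b ^ (-(u.length * d)) / p u * b ^ (-(n * d)))) := by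
        rw [rpow_neg_add_mul hb]
        field_simp
    _ ≤ 1 / C * (p u * p v) := by gcongr
    _ ≤ p (u ++ v) := hp.lower u v

lemma append_le_mul_rpow (hb : 0 < b) {u v : List α} {n : ℕ} (hv : p v ≤ b ^ (-(n * d))) :
    p (u ++ v) ≤ C * b ^ (u.length * d) * b ^ (-((u.length + n : ℕ) * d)) := by
  have hC := hp.pos
  calc p (u ++ v) ≤ C * (p u * p v) := hp.upper u v
    _ ≤ C * (1 * b ^ (-(n * d))) := by
        gcongr
        · exact hp.nonneg v
        · exact hp.le_one u
    _ = C * b ^ (u.length * d) * b ^ (-((u.length + n : ℕ) * d)) := by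
        rw [rpow_neg_add_mul hb, Real.rpow_neg hb.le (u.length * d)]
        field_simp

end IsQuasiMultiplicative

namespace IsCoding

variable {D ℓ : ℕ} {I : List (Fin (ℓ ^ D)) → Set (E D)} (hI : IsCoding I) {μ : Measure (E D)}
include hI

/-! ### The dimension of a quasi-Bernoulli measure -/

lemma le_dimH_of_measure_limsup_eq_zero (hℓ : 1 < ℓ) [IsFiniteMeasure μ]
    (hμ : μ (unitCube D)ᶜ = 0) {s : ℝ≥0}
    (h : μ (limsup (fun n => cubesWith I n fun w => (ℓ : ℝ) ^ (-(n * (s : ℝ))) ≤ μ.real (I w))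
      atTop) = 0) {A : Set (E D)} (hA : μ A ≠ 0) : s ≤ dimH A := by
  set G : ℕ → Set (E D) := fun n => cubesWith I n fun w => (ℓ : ℝ) ^ (-(n * (s : ℝ))) ≤ μ.real (I w)
  set S : ℕ → Set (E D) := fun N => {x ∈ A | ∀ n ≥ N, x ∉ G n}
  obtain ⟨N, hN⟩ : ∃ N, μ (S N) ≠ 0 := by
    by_contra! hS
    refine hA (measure_mono_null (fun x hx => or_iff_not_imp_left.2 fun hxl => ?_)
      (measure_union_null h (measure_iUnion_null hS)))
    rw [mem_limsup_iff_frequently_mem, not_frequently, eventually_atTop] at hxl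
    exact mem_iUnion.2 (hxl.imp fun N hN => ⟨hx, hN⟩)
  have hle : μ (S N) ≤ ENNReal.ofReal (5 ^ D * (ℓ : ℝ) ^ (s : ℝ)) * μH[s] (S N) := by
    refine measure_le_mul_hausdorffMeasure (N := N) (by exact_mod_cast hℓ) s.2 (by positivity)
      fun n hn U hU hdiam => ?_
    rw [ENNReal.ofReal_mul (by positivity), ENNReal.ofReal_pow (by positivity),
      ENNReal.ofReal_ofNat]
    refine hI.measure_le_of_forall_le (zero_lt_one.trans hℓ) hμ hdiam fun w hw ⟨x, hxw, hxU⟩ => ?_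
    have hlt := not_le.1 fun hle =>
      (hU hxU).2 n hn (mem_cubesWith.2 ⟨w, ⟨mem_words.1 hw, hle⟩, hxw⟩)
    exact (ofReal_measureReal (measure_ne_top μ _)).symm.trans_le (ENNReal.ofReal_le_ofReal hlt.le)
  have hne : μH[s] (S N) ≠ 0 := fun h0 => hN (le_antisymm (by simpa [h0] using hle) bot_le)
  exact (le_dimH_of_hausdorffMeasure_ne_zero hne).trans (dimH_mono fun x hx => hx.1)

lemma upperDim_le_of_measure_limsup_eq_zero (hℓ : 1 < ℓ) [IsFiniteMeasure μ]
    (hμ : μ (unitCube D) = 1) {s : ℝ≥0}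
    (h : μ (limsup (fun n => cubesWith I n fun w => μ.real (I w) ≤ (ℓ : ℝ) ^ (-(n * (s : ℝ))))
      atTop) = 0) : upperDim μ ≤ s := by
  have hℓ0 := zero_lt_one.trans hℓ
  have hcube : MeasurableSet (unitCube D) := hI.nil_eq hℓ0 ▸ hI.measurableSet []
  refine (iInf₂_le _ (hcube.diff (hI.measurableSet_limsup_cubesWith _))).trans
    ((iInf_le _ ((measure_sdiff_null h).trans hμ)).trans ?_)
  refine dimH_le_of_hausdorffMeasure_ne_top (ne_top_of_le_ne_top
    (ENNReal.mul_ne_top ENNReal.ofReal_ne_top (measure_ne_top μ univ))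
    ((measure_mono ?_).trans (hI.hausdorffMeasure_limsup_cubesWith_le hℓ s.2 one_pos)))
  rintro x ⟨hx, hxl⟩
  rw [mem_limsup_iff_frequently_mem, not_frequently] at hxl
  refine mem_limsup_iff_frequently_mem.2 (hxl.mono fun n hn => ?_).frequently
  obtain ⟨w, hw, hxw⟩ := hI.exists_mem hℓ0 hx n
  have hlt := not_le.1 fun hle => hn (mem_cubesWith.2 ⟨w, ⟨mem_words.1 hw, hle⟩, hxw⟩)
  exact mem_cubesWith.2 ⟨w, ⟨mem_words.1 hw, (one_mul _).trans_le hlt.le⟩, hxw⟩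

theorem hasDim (hℓ : 1 < ℓ) [IsFiniteMeasure μ] (hμ₁ : μ (unitCube D) = 1)
    (hμ : μ (unitCube D)ᶜ = 0) {C : ℝ} (hp : IsQuasiMultiplicative (fun w => μ.real (I w)) C)
    {d : ℝ≥0} (hd : HasDerivAt (wordSpectrum (fun w => μ.real (I w)) ℓ) (-d) 1) :
    HasDim μ d := by
  have hb : (1 : ℝ) < ℓ := by exact_mod_cast hℓ
  have hℓ0 := zero_lt_one.trans hℓ
  have hlower : (d : ℝ≥0∞) ≤ lowerDim μ := by
    refine le_iInf fun A => le_iInf₂ fun _ hA => ENNReal.le_of_forall_nnreal_lt fun s hs => ?_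
    obtain ⟨A, ρ, hρ₀, hρ₁, hle⟩ := hp.exists_sum_filter_ge_le hb hd (s := s) (by exact_mod_cast hs)
    exact hI.le_dimH_of_measure_limsup_eq_zero hℓ hμ
      (hI.measure_limsup_cubesWith_eq_zero hℓ0 hρ₀ hρ₁ hle) hA.ne'
  have hupper : upperDim μ ≤ d := by
    by_contra! hlt
    obtain ⟨s, hds, hs⟩ := ENNReal.lt_iff_exists_nnreal_btwn.1 hlt
    obtain ⟨A, ρ, hρ₀, hρ₁, hle⟩ :=
      hp.exists_sum_filter_le_le hb hd (s := s) (by exact_mod_cast hds)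
    exact hs.not_ge (hI.upperDim_le_of_measure_limsup_eq_zero hℓ hμ₁
      (hI.measure_limsup_cubesWith_eq_zero hℓ0 hρ₀ hρ₁ hle))
  have hle := lowerDim_le_upperDim μ
  exact ⟨le_antisymm (hle.trans hupper) hlower, le_antisymm hupper (hlower.trans hle)⟩

/-! ### Fluctuations -/

lemma measure_compl_iUnion_limsup_cubesWith (hℓ : 1 < ℓ) [IsFiniteMeasure μ]
    (hμ : μ (unitCube D)ᶜ = 0) {ι : Type*} [Countable ι] {P : ι → ℕ → List (Fin (ℓ ^ D)) → Prop}
    [∀ j n, DecidablePred (P j n)] {c : ℝ} (hc : 0 < c)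
    (h : ∀ u, μ.real (I u) ≠ 0 → ∃ j, ∃ᶠ n in atTop, c * μ.real (I u) ≤
      ∑ v ∈ words (Fin (ℓ ^ D)) n with P j (u.length + n) (u ++ v), μ.real (I (u ++ v))) :
    μ (⋃ j, limsup (fun n => cubesWith I n (P j n)) atTop)ᶜ = 0 := by
  refine hI.measure_compl_eq_zero hℓ hμ (MeasurableSet.iUnion fun j =>
    hI.measurableSet_limsup_cubesWith (P j)) (ENNReal.ofReal_pos.2 hc).ne' fun u => ?_
  rcases eq_or_ne (μ.real (I u)) 0 with hu | hu
  · rw [(measureReal_eq_zero_iff).1 hu, mul_zero]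
    exact zero_le
  obtain ⟨j, hj⟩ := h u hu
  rw [← ofReal_measureReal (measure_ne_top μ (I u)), ← ENNReal.ofReal_mul hc.le]
  exact (hI.le_measure_inter_limsup_cubesWith (zero_lt_one.trans hℓ) hj).trans
    (measure_mono (inter_subset_inter_right _ (subset_iUnion_of_subset j subset_rfl)))

theorem mutuallySingular_hausdorffMeasure (hℓ : 1 < ℓ) [IsFiniteMeasure μ]
    (hμ : μ (unitCube D)ᶜ = 0) {C : ℝ} (hp : IsQuasiMultiplicative (fun w => μ.real (I w)) C)
    {d : ℝ} (hd : 0 ≤ d)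
    (h : ∃ c > 0, ∀ K > 0, ∀ N : ℕ, ∃ n ≥ N, c ≤
      ∑ w ∈ words (Fin (ℓ ^ D)) n with K * (ℓ : ℝ) ^ (-(n * d)) ≤ μ.real (I w), μ.real (I w)) :
    μ ⟂ₘ μH[d] := by
  have hC := hp.pos
  obtain ⟨c, hc, hheavy⟩ := h
  set F : ℕ → Set (E D) := fun j => limsup (fun n => cubesWith I n fun w =>
    ((j : ℝ) + 1) * (ℓ : ℝ) ^ (-(n * d)) ≤ μ.real (I w)) atTop
  have hconull : ∀ j, μ (F j)ᶜ = 0 := fun j => by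
    rw [← iUnion_const (ι := Unit) (F j)]
    refine hI.measure_compl_iUnion_limsup_cubesWith hℓ hμ (div_pos hc hC) fun u hu =>
      ⟨(), frequently_atTop.2 fun N => ?_⟩
    have := hp.pos_of_ne_zero hu
    obtain ⟨n, hn, hsum⟩ := hheavy
      (((j : ℝ) + 1) * C * (ℓ : ℝ) ^ (-(u.length * d)) / μ.real (I u)) (by positivity) N
    refine ⟨n, hn, (hp.div_mul_le_sum_append hsum u).trans ?_⟩
    refine Finset.sum_le_sum_of_subset_of_nonneg (Finset.monotone_filter_right _ fun v _ hv => ?_)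
      fun v _ _ => measureReal_nonneg
    exact hp.mul_rpow_le_append (by positivity) hu hv
  have hlim : Tendsto (fun j : ℕ => ENNReal.ofReal (((D : ℝ) + 1) ^ d / ((j : ℝ) + 1)) * μ univ)
      atTop (𝓝 0) := by
    have := (tendsto_one_div_add_atTop_nhds_zero_nat (𝕜 := ℝ)).const_mul (((D : ℝ) + 1) ^ d)
    simpa [div_eq_mul_inv] using ENNReal.Tendsto.mul_const (ENNReal.tendsto_ofReal this)
      (Or.inr (measure_ne_top μ univ))
  refine ⟨(⋂ j, F j)ᶜ, (MeasurableSet.iInter fun j =>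
    hI.measurableSet_limsup_cubesWith _).compl, ?_, ?_⟩
  · rw [compl_iInter]
    exact measure_iUnion_null hconull
  · rw [compl_compl]
    exact le_antisymm (ge_of_tendsto' hlim fun j => (measure_mono (iInter_subset F j)).trans
      (hI.hausdorffMeasure_limsup_cubesWith_le hℓ hd (by positivity))) bot_le

end IsCoding

section Neighbours

variable {D ℓ : ℕ} {I : List (Fin (ℓ ^ D)) → Set (E D)} {μ : Measure (E D)}

open Classical in
/-- The words of the same length `n` as `w` whose cubes come within distance `ℓ ^ (-n)` of `I w`;
their cubes cover the part in the unit cube of the balls of that radius centred in `I w`. -/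
def neighbours (I : List (Fin (ℓ ^ D)) → Set (E D)) (w : List (Fin (ℓ ^ D))) :
    Finset (List (Fin (ℓ ^ D))) :=
  {w' ∈ words (Fin (ℓ ^ D)) w.length | ∃ x ∈ I w, ∃ y ∈ I w', dist x y ≤ ((ℓ : ℝ) ^ w.length)⁻¹}

/-- The total mass of the cubes that come within distance `ℓ ^ (-n)` of the cube `I w` of
generation `n`. -/
def neighbourMass (I : List (Fin (ℓ ^ D)) → Set (E D)) (μ : Measure (E D))
    (w : List (Fin (ℓ ^ D))) : ℝ :=
  ∑ w' ∈ neighbours I w, μ.real (I w')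

lemma mem_neighbours {w w' : List (Fin (ℓ ^ D))} : w' ∈ neighbours I w ↔
    w'.length = w.length ∧ ∃ x ∈ I w, ∃ y ∈ I w', dist x y ≤ ((ℓ : ℝ) ^ w.length)⁻¹ := by
  simp only [neighbours, Finset.mem_filter, mem_words]

lemma mem_neighbours_comm {w w' : List (Fin (ℓ ^ D))} :
    w' ∈ neighbours I w ↔ w ∈ neighbours I w' := by
  simp only [mem_neighbours]
  constructor <;>
  · rintro ⟨hlen, x, hx, y, hy, hxy⟩
    exact ⟨hlen.symm, y, hy, x, hx, by rwa [dist_comm, hlen]⟩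

lemma neighbourMass_nonneg (w : List (Fin (ℓ ^ D))) : 0 ≤ neighbourMass I μ w :=
  Finset.sum_nonneg fun _ _ => measureReal_nonneg

namespace IsCoding

variable (hI : IsCoding I)
include hI

lemma card_neighbours_le (hℓ : 0 < ℓ) (w : List (Fin (ℓ ^ D))) :
    (neighbours I w).card ≤ 5 ^ D := by
  refine hI.card_le_of_abs_corner_sub_le (fun w' hw' => (mem_neighbours.1 hw').1) (hI.corner w)
    fun w' hw' i => ?_
  obtain ⟨hlen, x, hx, y, hy, hxy⟩ := mem_neighbours.1 hw'
  exact hI.abs_corner_sub_le hℓ hlen (subset_closure hx) (subset_closure hy) hxy i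

lemma measure_closedBall_le (hℓ : 0 < ℓ) [IsFiniteMeasure μ] (hμ : μ (unitCube D)ᶜ = 0)
    {w : List (Fin (ℓ ^ D))} {x : E D} (hx : x ∈ I w) :
    μ (Metric.closedBall x ((ℓ : ℝ) ^ w.length)⁻¹) ≤ ENNReal.ofReal (neighbourMass I μ w) := by
  rw [neighbourMass, ENNReal.ofReal_sum_of_nonneg fun _ _ => measureReal_nonneg]
  simp only [ofReal_measureReal (measure_ne_top μ _)]
  refine hI.measure_le_sum_of_meets hℓ hμ fun w' hw' ⟨y, hy, hyx⟩ =>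
    mem_neighbours.2 ⟨mem_words.1 hw', x, hx, y, hy, ?_⟩
  rwa [dist_comm]

lemma sum_neighbourMass_le (hℓ : 0 < ℓ) {C : ℝ}
    (hp : IsQuasiMultiplicative (fun w => μ.real (I w)) C) (n : ℕ) :
    ∑ w ∈ words (Fin (ℓ ^ D)) n, neighbourMass I μ w ≤ 5 ^ D := by
  have hcomm : ∀ w w', w ∈ words (Fin (ℓ ^ D)) n ∧ w' ∈ neighbours I w ↔
      w ∈ neighbours I w' ∧ w' ∈ words (Fin (ℓ ^ D)) n := fun w w' => by
    rw [mem_neighbours_comm (w := w), and_comm, mem_words, mem_words]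
    exact and_congr_right fun h => by rw [(mem_neighbours.1 h).1]
  calc ∑ w ∈ words (Fin (ℓ ^ D)) n, neighbourMass I μ w
      = ∑ w' ∈ words (Fin (ℓ ^ D)) n, ∑ _w ∈ neighbours I w', μ.real (I w') :=
        Finset.sum_comm' hcomm
    _ ≤ ∑ w' ∈ words (Fin (ℓ ^ D)) n, 5 ^ D * μ.real (I w') := by
        refine Finset.sum_le_sum fun w' _ => ?_
        rw [Finset.sum_const, nsmul_eq_mul]
        gcongr
        exact_mod_cast hI.card_neighbours_le hℓ w'
    _ = 5 ^ D := by rw [← Finset.mul_sum, hp.sum_words, mul_one]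

lemma sum_filter_lt_neighbourMass_le (hℓ : 0 < ℓ) {C : ℝ}
    (hp : IsQuasiMultiplicative (fun w => μ.real (I w)) C) {R : ℝ} (hR : 0 < R)
    (u : List (Fin (ℓ ^ D))) (n : ℕ) :
    ∑ v ∈ words (Fin (ℓ ^ D)) n with R * μ.real (I (u ++ v)) < neighbourMass I μ (u ++ v),
      μ.real (I (u ++ v)) ≤ 5 ^ D / R := by
  have hnonneg := neighbourMass_nonneg (I := I) (μ := μ)
  rw [le_div_iff₀' hR, Finset.mul_sum]
  calc _ ≤ ∑ v ∈ words (Fin (ℓ ^ D)) n with R * μ.real (I (u ++ v)) < neighbourMass I μ (u ++ v),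
          neighbourMass I μ (u ++ v) :=
        Finset.sum_le_sum fun v hv => (Finset.mem_filter.1 hv).2.le
    _ ≤ ∑ v ∈ words (Fin (ℓ ^ D)) n, neighbourMass I μ (u ++ v) :=
        Finset.sum_le_sum_of_subset_of_nonneg (Finset.filter_subset _ _) fun v _ _ => hnonneg _
    _ ≤ ∑ w ∈ words (Fin (ℓ ^ D)) (u.length + n), neighbourMass I μ w := by
        rw [sum_words_add]
        exact Finset.single_le_sum
          (f := fun u => ∑ v ∈ words (Fin (ℓ ^ D)) n, neighbourMass I μ (u ++ v))
          (fun _ _ => Finset.sum_nonneg fun _ _ => hnonneg _) (mem_words.2 rfl)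
    _ ≤ 5 ^ D := hI.sum_neighbourMass_le hℓ hp _

lemma le_sum_filter_neighbourMass_le (hℓ : 0 < ℓ) {C : ℝ}
    (hp : IsQuasiMultiplicative (fun w => μ.real (I w)) C) {u : List (Fin (ℓ ^ D))}
    (hu : μ.real (I u) ≠ 0) {n : ℕ} {V : Finset (List (Fin (ℓ ^ D)))}
    (hV : V ⊆ words (Fin (ℓ ^ D)) n) {c : ℝ} (hc : 0 < c) (h : c ≤ ∑ v ∈ V, μ.real (I v)) :
    c / (2 * C) * μ.real (I u) ≤ ∑ v ∈ V with neighbourMass I μ (u ++ v) ≤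
      2 * 5 ^ D * C / (c * μ.real (I u)) * μ.real (I (u ++ v)), μ.real (I (u ++ v)) := by
  have hC := hp.pos
  have := hp.pos_of_ne_zero hu
  set R : ℝ := 2 * 5 ^ D * C / (c * μ.real (I u))
  have hfar : ∑ v ∈ V with ¬ neighbourMass I μ (u ++ v) ≤ R * μ.real (I (u ++ v)),
      μ.real (I (u ++ v)) ≤ c / (2 * C) * μ.real (I u) :=
    calc _ ≤ ∑ v ∈ words (Fin (ℓ ^ D)) n with
            R * μ.real (I (u ++ v)) < neighbourMass I μ (u ++ v), μ.real (I (u ++ v)) := by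
          simp only [not_le]
          exact Finset.sum_le_sum_of_subset_of_nonneg (Finset.filter_subset_filter _ hV)
            fun _ _ _ => measureReal_nonneg
      _ ≤ 5 ^ D / R := hI.sum_filter_lt_neighbourMass_le hℓ hp (by positivity) u n
      _ = c / (2 * C) * μ.real (I u) := by
          simp only [R]
          field_simp
  have hhalf : c / C * μ.real (I u) = 2 * (c / (2 * C) * μ.real (I u)) := by
    field_simp
  linarith [hp.div_mul_le_sum_append h u, Finset.sum_filter_add_sum_filter_not V
    (fun v => neighbourMass I μ (u ++ v) ≤ R * μ.real (I (u ++ v)))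
    fun v => μ.real (I (u ++ v))]

lemma measure_compl_iUnion_limsup_neighbourMass_le (hℓ : 1 < ℓ) [IsFiniteMeasure μ]
    (hμ : μ (unitCube D)ᶜ = 0) {C : ℝ} (hp : IsQuasiMultiplicative (fun w => μ.real (I w)) C)
    {c d : ℝ} (hc : 0 < c)
    (h : ∃ᶠ n : ℕ in atTop, c ≤
      ∑ w ∈ words (Fin (ℓ ^ D)) n with μ.real (I w) ≤ (ℓ : ℝ) ^ (-(n * d)), μ.real (I w)) :
    μ (⋃ j : ℕ, limsup (fun n => cubesWith I n fun w =>
      neighbourMass I μ w ≤ j * (ℓ : ℝ) ^ (-(n * d))) atTop)ᶜ = 0 := by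
  classical
  have hℓ0 := zero_lt_one.trans hℓ
  have hC := hp.pos
  refine hI.measure_compl_iUnion_limsup_cubesWith hℓ hμ (c := c / (2 * C)) (by positivity)
    fun u hu => ?_
  have := hp.pos_of_ne_zero hu
  set R : ℝ := 2 * 5 ^ D * C / (c * μ.real (I u))
  obtain ⟨j, hj⟩ := exists_nat_ge (R * (C * (ℓ : ℝ) ^ (u.length * d)))
  refine ⟨j, h.mono fun n hn => ?_⟩
  refine (hI.le_sum_filter_neighbourMass_le hℓ0 hp hu (Finset.filter_subset _ _) hc hn).trans ?_
  rw [Finset.filter_filter]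
  refine Finset.sum_le_sum_of_subset_of_nonneg
    (Finset.monotone_filter_right _ fun v _ hv => ?_) fun _ _ _ => measureReal_nonneg
  calc neighbourMass I μ (u ++ v) ≤ R * μ.real (I (u ++ v)) := hv.2
    _ ≤ R * (C * (ℓ : ℝ) ^ (u.length * d) * (ℓ : ℝ) ^ (-((u.length + n : ℕ) * d))) := by
        gcongr
        exact hp.append_le_mul_rpow (by positivity) hv.1
    _ ≤ j * (ℓ : ℝ) ^ (-((u.length + n : ℕ) * d)) := by
        rw [← mul_assoc]
        gcongr

theorem absolutelyContinuous_packingMeasure (hℓ : 1 < ℓ) [IsFiniteMeasure μ]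
    (hμ : μ (unitCube D)ᶜ = 0) {C : ℝ} (hp : IsQuasiMultiplicative (fun w => μ.real (I w)) C)
    {c d : ℝ} (hc : 0 < c)
    (h : ∃ᶠ n : ℕ in atTop, c ≤
      ∑ w ∈ words (Fin (ℓ ^ D)) n with μ.real (I w) ≤ (ℓ : ℝ) ^ (-(n * d)), μ.real (I w)) :
    μ ≪ packingMeasure d := by
  have hradius : Tendsto (fun n : ℕ => ((ℓ : ℝ) ^ n)⁻¹) atTop (𝓝[>] 0) :=
    tendsto_nhdsWithin_iff.2
      ⟨by simpa using tendsto_const_mul_inv_pow (b := ℓ) (by exact_mod_cast hℓ) 1,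
        Eventually.of_forall fun n => mem_Ioi.2 (by positivity)⟩
  refine QB.absolutelyContinuous_packingMeasure
    (measure_mono_null ?_ (hI.measure_compl_iUnion_limsup_neighbourMass_le hℓ hμ hp hc h))
  refine compl_subset_compl.2 fun x hx => ?_
  obtain ⟨j, hj⟩ := mem_iUnion.1 hx
  refine ⟨j, hradius.frequently ((mem_limsup_iff_frequently_mem.1 hj).mono fun n hn => ?_)⟩
  obtain ⟨w, ⟨rfl, hw⟩, hxw⟩ := mem_cubesWith.1 hn
  refine (hI.measure_closedBall_le (zero_lt_one.trans hℓ) hμ hxw).trans ?_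
  rw [inv_pow_rpow_eq (Nat.cast_nonneg ℓ), ← ENNReal.ofReal_natCast,
    ← ENNReal.ofReal_mul (Nat.cast_nonneg j)]
  exact ENNReal.ofReal_le_ofReal hw

end IsCoding

end Neighbours

/-! ### The support -/

/-- The word formed by the first `n` letters of the sequence `ω`. -/
def prefixWord {α : Type*} (n : ℕ) (ω : ℕ → α) : List α :=
  List.ofFn fun i : Fin n => ω i

section PrefixWord

variable {α : Type*} {n : ℕ} {ω ω' : ℕ → α}

@[simp] lemma length_prefixWord : (prefixWord n ω).length = n := List.length_ofFn

lemma prefixWord_succ : prefixWord (n + 1) ω = prefixWord n ω ++ [ω n] := by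
  simp only [prefixWord, List.ofFn_succ_last, Fin.val_castSucc, Fin.val_last]

lemma prefixWord_eq_iff : prefixWord n ω = prefixWord n ω' ↔ ∀ i < n, ω i = ω' i := by
  simp only [prefixWord, List.ofFn_inj, funext_iff]
  exact ⟨fun h i hi => h ⟨i, hi⟩, fun h i => h i i.2⟩

lemma infinitePi_prefixWord_eq_le [MeasurableSpace α] [MeasurableSingletonClass α] {ν : Measure α}
    [IsProbabilityMeasure ν] {c : ℝ≥0∞} (h : ∀ a, ν {a} ≤ c) (n : ℕ) (w : List α) :
    infinitePi (fun _ : ℕ => ν) {ω | prefixWord n ω = w} ≤ c ^ n := by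
  rcases eq_empty_or_nonempty {ω : ℕ → α | prefixWord n ω = w} with hempty | ⟨ω₀, rfl⟩
  · simp [hempty]
  have hcylinder : {ω : ℕ → α | prefixWord n ω = prefixWord n ω₀} =
      Set.pi (Finset.range n) fun i => {ω₀ i} := by
    ext ω
    simp [prefixWord_eq_iff]
  rw [hcylinder, infinitePi_pi _ fun i _ => measurableSet_singleton _]
  exact (Finset.prod_le_pow_card _ _ _ fun i _ => h _).trans_eq (by rw [Finset.card_range])

lemma IsQuasiMultiplicative.prefixWord_ne_zero [Finite α] {p : List α → ℝ} {C : ℝ}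
    (hp : IsQuasiMultiplicative p C) (h : ∀ i, p [ω i] ≠ 0) (n : ℕ) : p (prefixWord n ω) ≠ 0 := by
  induction n with
  | zero => simp [prefixWord, hp.nil]
  | succ n ih =>
    rw [prefixWord_succ, hp.append_ne_zero_iff]
    exact ⟨ih, h n⟩

lemma IsQuasiMultiplicative.exists_letter_measure [Finite α] [MeasurableSpace α]
    [MeasurableSingletonClass α] {p : List α → ℝ} {C b : ℝ} (hp : IsQuasiMultiplicative p C)
    (hb : 1 < b) : ∃ ν : Measure α, IsProbabilityMeasure ν ∧ (∀ᵐ a ∂ν, p [a] ≠ 0) ∧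
      ∀ a, ν {a} ≤ ENNReal.ofReal (b ^ (-wordSpectrum p b 0)) := by
  classical
  have := Fintype.ofFinite α
  set T : Finset α := {a | p [a] ≠ 0} with hT
  have hletters : chargedWords p 1 = T.map ⟨fun a => [a], List.singleton_injective⟩ := by
    ext w
    simp only [mem_chargedWords, Finset.mem_map, List.length_eq_one_iff]
    constructor
    · rintro ⟨⟨a, rfl⟩, ha⟩
      exact ⟨a, by simpa [hT] using ha, rfl⟩
    · rintro ⟨a, ha, rfl⟩
      exact ⟨⟨a, rfl⟩, by simpa [hT] using ha⟩
  have hne : T.Nonempty := by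
    simpa only [hletters, Finset.map_nonempty] using hp.chargedWords_nonempty 1
  have hcard : (T.card : ℝ) = b ^ wordSpectrum p b 0 := by
    simpa only [hletters, Finset.card_map, Nat.cast_one, one_mul] using hp.card_chargedWords hb 1
  refine ⟨(PMF.uniformOfFinset T hne).toMeasure, inferInstance, ?_, fun a => ?_⟩
  · rw [ae_iff, PMF.toMeasure_uniformOfFinset_apply _ _ (Set.toFinite _).measurableSet]
    simp [hT]
  · rw [PMF.toMeasure_apply_singleton _ _ (measurableSet_singleton a), PMF.uniformOfFinset_apply,
      Real.rpow_neg (by positivity), ← hcard,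
      ENNReal.ofReal_inv_of_pos (by exact_mod_cast hne.card_pos), ENNReal.ofReal_natCast]
    split_ifs
    · exact le_rfl
    · exact zero_le

end PrefixWord

namespace IsCoding

variable {D ℓ : ℕ} {I : List (Fin (ℓ ^ D)) → Set (E D)} (hI : IsCoding I) {μ : Measure (E D)}
include hI

lemma exists_mem_closure_of_mem_support (hℓ : 0 < ℓ) [IsFiniteMeasure μ]
    (hμ : μ (unitCube D)ᶜ = 0) {x : E D} (hx : x ∈ μ.support) (n : ℕ) :
    ∃ w ∈ chargedWords (fun w => μ.real (I w)) n, x ∈ closure (I w) := by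
  set F := ⋃ w ∈ chargedWords (fun w => μ.real (I w)) n, closure (I w)
  have hclosed : IsClosed F := (Finset.finite_toSet _).isClosed_biUnion fun w _ => isClosed_closure
  have hsub : Fᶜ ⊆ (unitCube D)ᶜ ∪ ⋃ w ∈ {w | μ (I w) = 0}, I w := fun y hy =>
    or_iff_not_imp_left.2 fun hyc => by
      obtain ⟨w, hw, hyw⟩ := hI.exists_mem hℓ (not_not.1 hyc) n
      refine mem_biUnion (by_contra fun hne => hy ?_) hyw
      refine mem_biUnion (mem_chargedWords.2 ⟨mem_words.1 hw, ?_⟩) (subset_closure hyw)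
      exact (measureReal_ne_zero_iff).2 hne
  have hnull : μ (⋃ w ∈ {w | μ (I w) = 0}, I w) = 0 :=
    (measure_biUnion_null_iff (to_countable _)).2 fun w hw => hw
  have hae : F ∈ ae μ := mem_ae_iff.2 (measure_mono_null hsub (measure_union_null hμ hnull))
  simpa only [F, mem_iUnion₂, exists_prop] using support_subset_of_isClosed hclosed hae hx

lemma mem_support_of_forall_mem_closure (hℓ : 1 < ℓ) {x : E D}
    (h : ∀ n, ∃ w ∈ chargedWords (fun w => μ.real (I w)) n, x ∈ closure (I w)) :
    x ∈ μ.support := by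
  refine (mem_support_iff_forall x).2 fun U hU => ?_
  obtain ⟨ε, hε, hball⟩ := Metric.mem_nhds_iff.1 hU
  obtain ⟨n, hn⟩ := ((tendsto_const_mul_inv_pow (b := ℓ) (by exact_mod_cast hℓ)
    ((D : ℝ) + 1)).eventually_lt_const hε).exists
  obtain ⟨w, hw, hxw⟩ := h n
  obtain ⟨rfl, hne⟩ := mem_chargedWords.1 hw
  have hpos : 0 < μ (I w) := pos_iff_ne_zero.2 fun h0 => hne (by simp [measureReal_def, h0])
  exact hpos.trans_le (measure_mono fun y hy =>
    hball ((hI.dist_le_of_mem_closure (subset_closure hy) hxw).trans_lt hn))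

lemma hausdorffMeasure_le_of_cover (hℓ : 1 < ℓ) {s B : ℝ} (hs : 0 ≤ s) {S : Set (E D)}
    {T : ℕ → Finset (List (Fin (ℓ ^ D)))} (hT : ∀ n, ∀ w ∈ T n, w.length = n)
    (hcover : ∀ᶠ n in atTop, S ⊆ ⋃ w ∈ T n, closure (I w))
    (hB : ∀ n, (T n).card * (ℓ : ℝ) ^ (-(n * s)) ≤ B) :
    μH[s] S ≤ ENNReal.ofReal (((D : ℝ) + 1) ^ s * B) := by
  have hlim : Tendsto (fun n : ℕ => ENNReal.ofReal (((D : ℝ) + 1) * ((ℓ : ℝ) ^ n)⁻¹)) atTop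
      (𝓝 0) := by
    simpa using ENNReal.tendsto_ofReal
      (tendsto_const_mul_inv_pow (b := ℓ) (by exact_mod_cast hℓ) ((D : ℝ) + 1))
  have hsum : ∀ n, ∑ w : T n, Metric.ediam (closure (I w.1)) ^ s ≤
      ENNReal.ofReal (((D : ℝ) + 1) ^ s * B) := fun n =>
    calc ∑ w : T n, Metric.ediam (closure (I w.1)) ^ s
        ≤ ∑ _w : T n, ENNReal.ofReal (((D : ℝ) + 1) ^ s * (ℓ : ℝ) ^ (-(n * s))) :=
          Finset.sum_le_sum fun w _ => by
            simpa only [hT n w w.2] using hI.ediam_closure_rpow_le hs w.1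
      _ = ENNReal.ofReal (((D : ℝ) + 1) ^ s * ((T n).card * (ℓ : ℝ) ^ (-(n * s)))) := by
          rw [Finset.sum_const, nsmul_eq_mul, Finset.card_univ, Fintype.card_coe,
            ← ENNReal.ofReal_natCast, ← ENNReal.ofReal_mul (by positivity), mul_left_comm]
      _ ≤ ENNReal.ofReal (((D : ℝ) + 1) ^ s * B) :=
          ENNReal.ofReal_le_ofReal (mul_le_mul_of_nonneg_left (hB n) (by positivity))
  refine (hausdorffMeasure_le_liminf_sum s S _ hlim (fun n (w : T n) => closure (I w.1))
    (Eventually.of_forall fun n w => ?_) (hcover.mono fun n hn => ?_)).trans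
    ((liminf_le_liminf (Eventually.of_forall hsum)).trans (by simp))
  · simpa only [hT n w w.2] using hI.ediam_closure_le w.1
  · rwa [← iUnion_subtype (fun w => w ∈ T n) fun w => closure (I w.1)] at hn

lemma dimH_support_le (hℓ : 1 < ℓ) [IsFiniteMeasure μ] (hμ : μ (unitCube D)ᶜ = 0) {C : ℝ}
    (hp : IsQuasiMultiplicative (fun w => μ.real (I w)) C) {δ : ℝ≥0}
    (hδ : δ = wordSpectrum (fun w => μ.real (I w)) ℓ 0) : dimH μ.support ≤ δ := by
  have hb : (1 : ℝ) < ℓ := by exact_mod_cast hℓ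
  have hfinite : μH[(δ : ℝ)] μ.support ≤ ENNReal.ofReal (((D : ℝ) + 1) ^ (δ : ℝ) * 1) := by
    refine hI.hausdorffMeasure_le_of_cover hℓ δ.coe_nonneg (T := chargedWords fun w => μ.real (I w))
      (fun n w hw => (mem_chargedWords.1 hw).1) (Eventually.of_forall fun n x hx => ?_)
      fun n => ?_
    · simpa only [mem_iUnion₂, exists_prop] using
        hI.exists_mem_closure_of_mem_support (zero_lt_one.trans hℓ) hμ hx n
    · rw [hp.card_chargedWords hb, ← hδ, ← Real.rpow_add (one_pos.trans hb)]
      simp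
  exact dimH_le_of_hausdorffMeasure_ne_top (ne_top_of_le_ne_top ENNReal.ofReal_ne_top hfinite)

lemma exists_measurable_mem_closure (hℓ : 1 < ℓ) :
    ∃ π : (ℕ → Fin (ℓ ^ D)) → E D, Measurable π ∧ ∀ ω n, π ω ∈ closure (I (prefixWord n ω)) := by
  choose pt hpt using hI.nonempty (zero_lt_one.trans hℓ)
  have hanti : ∀ ω : ℕ → Fin (ℓ ^ D), Antitone fun n => I (prefixWord n ω) := fun ω =>
    antitone_nat_of_succ_le fun n => prefixWord_succ (ω := ω) ▸ hI.append_subset _ _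
  have hcauchy : ∀ ω : ℕ → Fin (ℓ ^ D), CauchySeq fun n => pt (prefixWord n ω) := fun ω => by
    refine cauchySeq_of_le_geometric (ℓ : ℝ)⁻¹ ((D : ℝ) + 1)
      (inv_lt_one_of_one_lt₀ (by exact_mod_cast hℓ)) fun n => ?_
    simpa only [length_prefixWord, inv_pow] using
      hI.dist_le_of_mem_closure (subset_closure (hpt (prefixWord n ω)))
        (subset_closure (hanti ω n.le_succ (hpt (prefixWord (n + 1) ω))))
  choose π hπ using fun ω => cauchySeq_tendsto_of_complete (hcauchy ω)
  refine ⟨π, measurable_of_tendsto_metrizable (fun n => ?_) (tendsto_pi_nhds.2 hπ),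
    fun ω n => mem_closure_of_tendsto (hπ ω) (eventually_atTop.2 ⟨n, fun k hk => ?_⟩)⟩
  · exact (Measurable.of_discrete (f := fun v : Fin n → Fin (ℓ ^ D) => pt (List.ofFn v))).comp
      (measurable_pi_lambda _ fun i => measurable_pi_apply _)
  · exact hanti ω hk (hpt _)

lemma map_le_of_forall_mem_closure (hℓ : 0 < ℓ) {Ω : Type*} [MeasurableSpace Ω] {ν : Measure Ω}
    {π : Ω → E D} (hπ : Measurable π) {n : ℕ} {u : Ω → List (Fin (ℓ ^ D))}
    (hu : ∀ ω, (u ω).length = n) (hmem : ∀ ω, π ω ∈ closure (I (u ω))) {U : Set (E D)}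
    (hU : Metric.ediam U ≤ ENNReal.ofReal ((ℓ : ℝ) ^ n)⁻¹) {B : ℝ≥0∞}
    (hB : ∀ w, ν {ω | u ω = w} ≤ B) : ν.map π U ≤ 5 ^ D * B := by
  classical
  set T := {w ∈ words (Fin (ℓ ^ D)) n | (closure (I w) ∩ closure U).Nonempty}
  have hcard : T.card ≤ 5 ^ D := hI.card_le_of_meets hℓ
    (fun w hw => mem_words.1 (Finset.mem_filter.1 hw).1) (by rwa [Metric.ediam_closure])
    fun w hw => (Finset.mem_filter.1 hw).2
  have hpre : π ⁻¹' closure U ⊆ ⋃ w ∈ T, {ω | u ω = w} := fun ω hω =>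
    mem_biUnion (Finset.mem_filter.2 ⟨mem_words.2 (hu ω), π ω, hmem ω, hω⟩) rfl
  calc ν.map π U ≤ ν.map π (closure U) := measure_mono subset_closure
    _ = ν (π ⁻¹' closure U) := map_apply hπ isClosed_closure.measurableSet
    _ ≤ ∑ w ∈ T, ν {ω | u ω = w} := (measure_mono hpre).trans (measure_biUnion_finset_le _ _)
    _ ≤ T.card • B := Finset.sum_le_card_nsmul _ _ _ fun w _ => hB w
    _ ≤ 5 ^ D * B := by
        rw [nsmul_eq_mul]
        gcongr
        exact_mod_cast hcard

/-- The measure comes from the sequences of independent letters, uniform among the charged ones. -/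
lemma exists_measure_le_and_ae_mem_support (hℓ : 1 < ℓ) {C : ℝ}
    (hp : IsQuasiMultiplicative (fun w => μ.real (I w)) C) {δ : ℝ}
    (hδ : δ = wordSpectrum (fun w => μ.real (I w)) ℓ 0) :
    ∃ ν : Measure (E D), ν ≠ 0 ∧ (∀ᵐ x ∂ν, x ∈ μ.support) ∧
      ∀ (n : ℕ) (U : Set (E D)), Metric.ediam U ≤ ENNReal.ofReal ((ℓ : ℝ) ^ n)⁻¹ →
        ν U ≤ ENNReal.ofReal (5 ^ D * (ℓ : ℝ) ^ (-(n * δ))) := by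
  obtain ⟨ν, hν, hcharged, hle⟩ := hp.exists_letter_measure (b := ℓ) (by exact_mod_cast hℓ)
  obtain ⟨π, hπ, hmem⟩ := hI.exists_measurable_mem_closure hℓ
  refine ⟨(infinitePi fun _ : ℕ => ν).map π, ?_, ?_, fun n U hU => ?_⟩
  · exact (Measure.isProbabilityMeasure_map hπ.aemeasurable).ne_zero
  · refine (ae_map_iff (p := (· ∈ μ.support)) hπ.aemeasurable
      isClosed_support.measurableSet).2 ?_
    have hletters : ∀ᵐ ω ∂infinitePi fun _ : ℕ => ν, ∀ i, μ.real (I [ω i]) ≠ 0 :=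
      ae_all_iff.2 fun i =>
        (measurePreserving_eval_infinitePi (fun _ : ℕ => ν) i).quasiMeasurePreserving.ae hcharged
    filter_upwards [hletters] with ω hω
    exact hI.mem_support_of_forall_mem_closure hℓ fun n => ⟨prefixWord n ω,
      mem_chargedWords.2 ⟨length_prefixWord, hp.prefixWord_ne_zero hω n⟩, hmem ω n⟩
  · refine (hI.map_le_of_forall_mem_closure (zero_lt_one.trans hℓ) hπ
      (fun ω => length_prefixWord) (hmem · n) hU fun w =>
        infinitePi_prefixWord_eq_le hle n w).trans_eq ?_
    rw [← hδ, ENNReal.ofReal_mul (by positivity), ENNReal.ofReal_pow (by norm_num),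
      ENNReal.ofReal_ofNat, ← ENNReal.ofReal_pow (by positivity), ← Real.rpow_mul_natCast
      (Nat.cast_nonneg ℓ), neg_mul, mul_comm δ]

lemma le_dimH_support (hℓ : 1 < ℓ) {C : ℝ}
    (hp : IsQuasiMultiplicative (fun w => μ.real (I w)) C) {δ : ℝ≥0}
    (hδ : δ = wordSpectrum (fun w => μ.real (I w)) ℓ 0) : δ ≤ dimH μ.support := by
  obtain ⟨ν, hν, hsupp, hle⟩ := hI.exists_measure_le_and_ae_mem_support hℓ hp hδ
  refine le_dimH_of_hausdorffMeasure_ne_zero fun hzero => hν ?_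
  have hbound := measure_le_mul_hausdorffMeasure (μ := ν) (N := 0) (b := ℓ) (by exact_mod_cast hℓ)
    δ.coe_nonneg (by positivity) (S := μ.support) fun n _ U _ => hle n U
  rw [hzero, mul_zero, nonpos_iff_eq_zero] at hbound
  rw [← measure_univ_eq_zero, ← union_compl_self μ.support]
  exact measure_union_null hbound hsupp

/-! ### Affine spectra -/

lemma hausdorffMeasure_le_of_closedBall_subset (hℓ : 1 < ℓ) [IsFiniteMeasure μ]
    (hμ : μ (unitCube D)ᶜ = 0) {C s : ℝ} (hC : 0 ≤ C) (hs : 0 ≤ s)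
    (h : ∀ w, μ.real (I w) ≠ 0 → (ℓ : ℝ) ^ (-(w.length * s)) ≤ C * μ.real (I w))
    {S U : Set (E D)} (hS : S ⊆ μ.support) {r : ℝ} (hr : 0 < r)
    (hU : ∀ x ∈ S, Metric.closedBall x r ⊆ U) :
    μH[s] S ≤ ENNReal.ofReal (((D : ℝ) + 1) ^ s * C) * μ U := by
  classical
  have hℓ0 := zero_lt_one.trans hℓ
  set T := fun n => {w ∈ chargedWords (fun w => μ.real (I w)) n | closure (I w) ⊆ U}
  have hT : ∀ n, ∀ w ∈ T n, w.length = n ∧ μ.real (I w) ≠ 0 ∧ closure (I w) ⊆ U := fun n w hw => by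
    simpa [T, mem_chargedWords, and_assoc] using hw
  rw [← ofReal_measureReal (measure_ne_top μ U), ← ENNReal.ofReal_mul (by positivity), mul_assoc]
  refine hI.hausdorffMeasure_le_of_cover hℓ hs (T := T) (fun n w hw => (hT n w hw).1) ?_ fun n => ?_
  · filter_upwards [(tendsto_const_mul_inv_pow (b := ℓ) (by exact_mod_cast hℓ)
      ((D : ℝ) + 1)).eventually_lt_const hr] with n hn x hx
    obtain ⟨w, hw, hxw⟩ := hI.exists_mem_closure_of_mem_support hℓ0 hμ (hS hx) n
    refine mem_biUnion (Finset.mem_filter.2 ⟨hw, fun y hy => hU x hx ?_⟩) hxw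
    rw [← (mem_chargedWords.1 hw).1] at hn
    exact (hI.dist_le_of_mem_closure hy hxw).trans hn.le
  · calc (T n).card * (ℓ : ℝ) ^ (-(n * s)) = ∑ _w ∈ T n, (ℓ : ℝ) ^ (-(n * s)) := by
          rw [Finset.sum_const, nsmul_eq_mul]
      _ ≤ ∑ w ∈ T n, C * μ.real (I w) := Finset.sum_le_sum fun w hw => by
          simpa only [(hT n w hw).1] using h w (hT n w hw).2.1
      _ = C * μ.real (⋃ w ∈ T n, I w) := by
          rw [← Finset.mul_sum, measureReal_biUnion_finset
            (hI.pairwiseDisjoint hℓ0 fun w hw => (hT n w hw).1) fun w _ => hI.measurableSet w]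
      _ ≤ C * μ.real U := by
          refine mul_le_mul_of_nonneg_left (measureReal_mono ?_) hC
          exact iUnion₂_subset fun w hw => subset_closure.trans (hT n w hw).2.2

lemma restrict_hausdorffMeasure_support_le (hℓ : 1 < ℓ) [IsFiniteMeasure μ]
    (hμ : μ (unitCube D)ᶜ = 0) {C s : ℝ} (hC : 0 ≤ C) (hs : 0 ≤ s)
    (h : ∀ w, μ.real (I w) ≠ 0 → (ℓ : ℝ) ^ (-(w.length * s)) ≤ C * μ.real (I w)) :
    (μH[s]).restrict μ.support ≤ (((D : ℝ) + 1) ^ s * C).toNNReal • μ := by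
  refine le_of_forall_isOpen fun U hU => ?_
  set S : ℕ → Set (E D) := fun n => {x ∈ μ.support | Metric.closedBall x (1 / (n + 1)) ⊆ U}
  have hmono : Monotone S := fun n k hnk x hx =>
    ⟨hx.1, (Metric.closedBall_subset_closedBall (Nat.one_div_le_one_div hnk)).trans hx.2⟩
  have hcover : U ∩ μ.support ⊆ ⋃ n, S n := fun x ⟨hxU, hx⟩ => by
    obtain ⟨ε, hε, hball⟩ := Metric.isOpen_iff.1 hU x hxU
    obtain ⟨n, hn⟩ := exists_nat_one_div_lt hε
    exact mem_iUnion.2 ⟨n, hx, (Metric.closedBall_subset_ball hn).trans hball⟩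
  rw [restrict_apply hU.measurableSet]
  refine (measure_mono hcover).trans ?_
  rw [hmono.measure_iUnion]
  exact iSup_le fun n => hI.hausdorffMeasure_le_of_closedBall_subset hℓ hμ hC hs h
    (fun x hx => hx.1) Nat.one_div_pos_of_nat fun x hx => hx.2

lemma le_smul_hausdorffMeasure (hℓ : 1 < ℓ) [IsFiniteMeasure μ]
    (hμ : μ (unitCube D)ᶜ = 0) {C s : ℝ} (hC : 0 < C) (hs : 0 ≤ s)
    (h : ∀ w, μ.real (I w) ≤ C * (ℓ : ℝ) ^ (-(w.length * s))) :
    μ ≤ (5 ^ D * C * (ℓ : ℝ) ^ s).toNNReal • (μH[s] : Measure (E D)) := by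
  intro S
  refine measure_le_mul_hausdorffMeasure (N := 0) (by exact_mod_cast hℓ) hs (by positivity)
    fun n _ U _ hU => ?_
  rw [mul_assoc, ENNReal.ofReal_mul (by positivity), ENNReal.ofReal_pow (by norm_num),
    ENNReal.ofReal_ofNat]
  refine hI.measure_le_of_forall_le (zero_lt_one.trans hℓ) hμ hU fun w hw _ => ?_
  rw [← ofReal_measureReal (measure_ne_top μ (I w)), ← mem_words.1 hw]
  exact ENNReal.ofReal_le_ofReal (h w)

theorem stronglyEquivalent_restrict_hausdorffMeasure (hℓ : 1 < ℓ) [IsFiniteMeasure μ]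
    (hμ : μ (unitCube D)ᶜ = 0) {C s : ℝ} (hC : 0 < C) (hs : 0 ≤ s)
    (hle : ∀ w, μ.real (I w) ≤ C * (ℓ : ℝ) ^ (-(w.length * s)))
    (hge : ∀ w, μ.real (I w) ≠ 0 → (ℓ : ℝ) ^ (-(w.length * s)) ≤ C * μ.real (I w)) :
    StronglyEquivalent μ ((μH[s]).restrict μ.support) := by
  refine stronglyEquivalent_of_le_smul (K := (5 ^ D * C * (ℓ : ℝ) ^ s).toNNReal) ?_
    (hI.restrict_hausdorffMeasure_support_le hℓ hμ hC.le hs hge)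
  rw [← Measure.restrict_smul]
  conv_lhs => rw [← restrict_eq_self_of_ae_mem (μ := μ) (s := μ.support) support_mem_ae]
  exact restrict_mono subset_rfl (hI.le_smul_hausdorffMeasure hℓ hμ hC hs hle)

end IsCoding

end QB

end

theorem mainTheorem12 (D ℓ : ℕ) (hℓ : 2 ≤ ℓ)
    (I : List (Fin (ℓ ^ D)) → Set (QB.E D)) (hI : QB.IsCoding I)
    (m : MeasureTheory.Measure (QB.E D)) (hm : QB.IsQuasiBernoulli I m)
    (hτ : AnalyticOnNhd ℝ (QB.lqSpectrum ℓ m) Set.univ) :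
    ∃ d δ : NNReal, QB.HasDim m d ∧ dimH m.support = δ ∧
      ((d = δ ∧ QB.StronglyEquivalent m
          ((MeasureTheory.Measure.hausdorffMeasure (δ : ℝ)).restrict m.support)) ∨
        (d < δ ∧
          MeasureTheory.Measure.MutuallySingular m
            (MeasureTheory.Measure.hausdorffMeasure (d : ℝ)) ∧
          MeasureTheory.Measure.AbsolutelyContinuous m (QB.packingMeasure (d : ℝ)))) := by
  have := hm.isProbabilityMeasure
  have hb : (1 : ℝ) < ℓ := by exact_mod_cast hℓ
  have hℓ₀ : 0 < ℓ := by lia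
  have hcube := hI.measure_compl_unitCube hℓ₀ hm.measure_unitCube
  obtain ⟨C, hp⟩ := hm.exists_isQuasiMultiplicative hI hℓ₀
  rw [hI.lqSpectrum_eq_wordSpectrum hℓ₀] at hτ
  have hder := (hτ 1 (Set.mem_univ 1)).differentiableAt.hasDerivAt
  rw [← neg_neg (deriv _ 1)] at hder
  have hd_le := hp.neg_deriv_le_wordSpectrum_zero hb hder
  lift -deriv (QB.wordSpectrum (fun w => m.real (I w)) ℓ) 1 to NNReal
    using hp.neg_deriv_nonneg hb hder with d
  obtain ⟨δ, hδ⟩ := CanLift.prf (β := NNReal) _ (d.coe_nonneg.trans hd_le)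
  refine ⟨d, δ, hI.hasDim hℓ hm.measure_unitCube hcube hp hder,
    le_antisymm (hI.dimH_support_le hℓ hcube hp hδ) (hI.le_dimH_support hℓ hp hδ), ?_⟩
  rcases (NNReal.coe_le_coe.1 (hd_le.trans_eq hδ.symm)).eq_or_lt with rfl | hlt
  · have haff := hp.wordSpectrum_eq_of_neg_deriv_eq hb hder hτ hδ
    exact .inl ⟨rfl, hI.stronglyEquivalent_restrict_hausdorffMeasure hℓ hcube hp.pos d.coe_nonneg
      (hp.le_of_affine hb haff) fun w => hp.ge_of_affine hb haff⟩
  · have hlt' := (NNReal.coe_lt_coe.2 hlt).trans_eq hδ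
    obtain ⟨c, hc, hbelow⟩ := hp.exists_le_sum_filter_le hb hder hτ hlt'
    exact .inr ⟨hlt, hI.mutuallySingular_hausdorffMeasure hℓ hcube hp d.coe_nonneg
        (hp.exists_le_sum_filter_ge hb hder hτ hlt'),
      hI.absolutelyContinuous_packingMeasure hℓ hcube hp hc
        (frequently_atTop.2 fun N => by simpa using hbelow 1 one_pos N)⟩
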